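/- Fix $N\ge 1$ edge types and write $[N]=\{1,\dots,N\}$. Let $G_0$ be a (deterministic) finite loopless multigraph whose edges carry types in $[N]$, with at least one edge of each type. The generalized Barabási–Albert process $(G_n)_{n\ge 0}$ is defined as follows. Let $V_n$ be the vertex set of $G_n$, let $\deg_n^{(k)}(v)$ be the number of type-$k$ edges at $v$ in $G_n$, let $\deg_n(v)=\sum_{k=1}^N\deg_n^{(k)}(v)$, and let $\mathcal F_n$ be the $\sigma$-algebra generated by $G_0,\dots,G_n$. In step $n\ge 1$ a new vertex $v_n$ is added together with $M_n$ new edges joining it to vertices of $G_{n-1}$ (repetitions allowed), where $M_n$ is a positive-integer-valued random variable independent of $\mathcal F_{n-1}$. Conditionally on $\mathcal F_{n-1}$ and $M_n$, the (old endpoint, type) pairs of the $M_n$ new edges are chosen independently of each other: the endpoint is $v\in V_{n-1}$ with probability $\deg_{n-1}(v)/\sum_{u\in V_{n-1}}\deg_{n-1}(u)$ and, given the endpoint $v$, the type is $k$ with probability $\deg^{(k)}_{n-1}(v)/\deg_{n-1}(v)$. Assume that there is a positive-integer-valued random variable $M$ such that $M_n\to M$ in distribution and $\mathbb E(M_n^p)\to\mathbb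 E(M^p)<\infty$ for every $p\ge 1$. Assume in addition that $M_1,M_2,\dots$ are identically distributed and that there is $z>1$ with $$\sum_{l=1}^\infty\frac{\mathbb E(M_1^l)}{l\cdot l!}\,z^l<\infty .$$ (a) For every type $k\in[N]$ there are random variables $x_l^{(k)}$ ($l\ge 0$) and $C_k$ such that, almost surely, $$\frac{|\{v\in V_n:\deg_n^{(k)}(v)=l\}|}{|V_n|}\longrightarrow x_l^{(k)}\quad(n\to\infty)\quad\text{for all } l\ge 0,\qquad \sum_{l=0}^\infty x_l^{(k)}=1,$$ and $x_l^{(k)}\,l^3\to C_k$ as $l\to\infty$ with $C_k>0$. That is, the asymptotic type-$k$ degree distribution $(x_l^{(k)})_{l\ge0}$ exists and has characteristic exponent $3$. (b) There are deterministic numbers $z_d$ ($d\ge 0$) with $\sum_{d=0}^\infty z_d=1$ and a deterministic constant $C>0$ such that, almost surely, $$\frac{|\{v\in V_n:\deg_n(v)=d\}|}{|V_n|}\longrightarrow z_d\quad(n\to\infty)\quad\text{for all } d\ge 0,$$ and $z_d\,d^3\to C$ as $d\to\infty$. That is, the total degree distribution also has characteristic exponent $3$. -/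

import Mathlib

open MeasureTheory ProbabilityTheory Filter Topology
open scoped ENNReal NNReal Nat

/-- A finite multigraph without loops on the vertex set `{0, …, numVertices - 1}`, each of whose
edges carries one of `N` types. Multiple edges are allowed. -/
structure TypedMultigraph (N : ℕ) where
  numVertices : ℕ
  edges : Multiset (Sym2 ℕ × Fin N)
  mem_vertices : ∀ e ∈ edges, ∀ v ∈ e.1, v < numVertices
  loopless : ∀ e ∈ edges, ¬ e.1.IsDiag

namespace TypedMultigraph

variable {N : ℕ}

/-- The discrete σ-algebra on the (countable) set of typed multigraphs. -/
instance : MeasurableSpace (TypedMultigraph N) := ⊤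

/-- The number of edges of type `k`. -/
def numEdges (G : TypedMultigraph N) (k : Fin N) : ℕ :=
  G.edges.countP (fun e => e.2 = k)

/-- The type-`k` degree of `v`: the number of edges of type `k` that are incident to `v`. -/
def typeDegree (G : TypedMultigraph N) (k : Fin N) (v : ℕ) : ℕ :=
  G.edges.countP (fun e => v ∈ e.1 ∧ e.2 = k)

/-- The total degree of `v`, over all types. -/
def degree (G : TypedMultigraph N) (v : ℕ) : ℕ :=
  ∑ k, G.typeDegree k v

/-- The number of vertices of type-`k` degree `l`. -/
def countTypeDegree (G : TypedMultigraph N) (k : Fin N) (l : ℕ) : ℕ :=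
  ((Finset.range G.numVertices).filter (fun v => G.typeDegree k v = l)).card

/-- The number of vertices of total degree `d`. -/
def countDegree (G : TypedMultigraph N) (d : ℕ) : ℕ :=
  ((Finset.range G.numVertices).filter (fun v => G.degree v = d)).card

/-- The probability that one new edge is attached to the old vertex `v` and gets type `k`: the
endpoint `v` is chosen with probability proportional to its degree, and then the type `k` is chosen
with probability equal to the proportion of type `k` among the edges at `v`.
It is `0` when `v` is isolated or is not a vertex of `G`. -/
noncomputable def attachProb (G : TypedMultigraph N) (v : ℕ) (k : Fin N) : ℝ :=
  ((G.degree v : ℝ) / ∑ u ∈ Finset.range G.numVertices, (G.degree u : ℝ)) *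
    ((G.typeDegree k v : ℝ) / (G.degree v : ℝ))

end TypedMultigraph

/-- The σ-algebra `ℱ n` generated by the graphs `G 0, …, G n` (`G 0` will be deterministic). -/
abbrev graphHistory {Ω : Type*} {N : ℕ} (G : ℕ → Ω → TypedMultigraph N) (n : ℕ) :
    MeasurableSpace Ω :=
  ⨆ i ≤ n, MeasurableSpace.comap (G i) ⊤

/-- `G` is a generalized Barabási–Albert process with edge types in `Fin N` and deterministic
initial graph `G₀`. In step `n + 1` the vertex with label `(G n).numVertices` is born and sends
`M (n + 1)` edges to old vertices; the `i`-th of them, `i < M (n + 1)`, has old endpoint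
`Y (n + 1) i` and type `T (n + 1) i`. The values `M 0`, `Y 0`, `T 0`, and `Y n i`, `T n i` for
`i ≥ M n`, play no role. -/
structure IsGenBarabasiAlbert {Ω : Type*} [MeasurableSpace Ω] (μ : Measure Ω) {N : ℕ}
    (G₀ : TypedMultigraph N) (M : ℕ → Ω → ℕ) (Y : ℕ → ℕ → Ω → ℕ) (T : ℕ → ℕ → Ω → Fin N)
    (G : ℕ → Ω → TypedMultigraph N) : Prop where
  /-- Every type is present in the initial graph. -/
  numEdges_pos : ∀ k, 0 < G₀.numEdges k
  init : ∀ ω, G 0 ω = G₀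
  measurable_M : ∀ n, Measurable (M (n + 1))
  measurable_Y : ∀ n i, Measurable (Y (n + 1) i)
  measurable_T : ∀ n i, Measurable (T (n + 1) i)
  measurable_G : ∀ n, Measurable (G n)
  numVertices_succ : ∀ n ω, (G (n + 1) ω).numVertices = (G n ω).numVertices + 1
  edges_succ : ∀ n ω, (G (n + 1) ω).edges = (G n ω).edges +
    (Multiset.range (M (n + 1) ω)).map
      (fun i => (s((G n ω).numVertices, Y (n + 1) i ω), T (n + 1) i ω))
  M_pos : ∀ n ω, 0 < M (n + 1) ω
  /-- The number of new edges is independent of the past. -/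
  indep_M : ∀ n, Indep (MeasurableSpace.comap (M (n + 1)) ⊤) (graphHistory G n) μ
  /-- Conditionally on the past and on the number of new edges, the new edges are chosen
  independently of each other, with probabilities given by the old graph `G n`. -/
  attach : ∀ (n m : ℕ) (v : Fin m → ℕ) (k : Fin m → Fin N),
    μ[Set.indicator
        {ω | M (n + 1) ω = m ∧ ∀ i : Fin m, Y (n + 1) i ω = v i ∧ T (n + 1) i ω = k i}
        (fun _ => (1 : ℝ)) | graphHistory G n ⊔ MeasurableSpace.comap (M (n + 1)) ⊤]
      =ᵐ[μ] fun ω => if M (n + 1) ω = m then ∏ i : Fin m, (G n ω).attachProb (v i) (k i) else 0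

/-- The number of new edges converges in distribution to the positive random variable `L`, with
convergence of all moments of order `p ≥ 1` to the finite moments of `L`. -/
structure EdgeNumbersConverge {Ω Ω' : Type*} [MeasurableSpace Ω] [MeasurableSpace Ω']
    (μ : Measure Ω) [IsProbabilityMeasure μ] (M : ℕ → Ω → ℕ)
    (μ' : Measure Ω') [IsProbabilityMeasure μ'] (L : Ω' → ℕ) : Prop where
  pos : ∀ ω, 0 < L ω
  tendsto_law : TendstoInDistribution (fun n => M (n + 1)) atTop L (fun _ => μ) μ'
  moment_lt_top : ∀ p : ℝ, 1 ≤ p → ∫⁻ ω, (L ω : ℝ≥0∞) ^ p ∂μ' < ∞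
  tendsto_moment : ∀ p : ℝ, 1 ≤ p →
    Tendsto (fun n => ∫⁻ ω, (M (n + 1) ω : ℝ≥0∞) ^ p ∂μ) atTop
      (𝓝 (∫⁻ ω, (L ω : ℝ≥0∞) ^ p ∂μ'))

/-! Both parts are one statement about a set `K` of types: take `K = {k}` for the typed degrees and
`K = Finset.univ` for the total degree. Choosing an endpoint and then a type amounts to choosing a
half-edge uniformly, so, given the past and `m` new edges, the new vertex gets a binomial number of
edges in `K` with success probability the current proportion of such edges, and an old vertex of
`K`-degree `d` gains a binomial number with success probability `d / (2E)`, where `E` is the number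
of edges.

The proportion is a bounded martingale (a Pólya urn fed in batches), so it converges to some `p`. It
stays away from `0`: with `h = halfProd`, which decays like `n ^ (-1/2)`, the ratio `h a / h A` of
the edge counts in `K` and in total has nonincreasing expectation and dominates the square root of
the inverse proportion, so Fatou's lemma excludes `p = 0` (`ae_limit_pos`).

Let `q` be the mixture of binomials with parameter `p` over the law of `M`. A strong law for
martingale differences gives `E ~ 𝔼(M) n`, and it makes the vertex counts follow their conditional
means. Up to small errors, one step adds `q l + ((l - 1) X (l - 1) - l X l) / (2n)` to the number `X
l` of vertices of degree `l`. Induction on `l` gives limits with `(l + 2) x l = 2 q l + (l - 1) x (l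
- 1)` (`ae_tendsto_countDegreeIn_div`). Multiplied by `l (l + 1)` this telescopes, so `l ^ 3 x l`
tends to `2 ∑ j (j + 1) q j`, which is finite because `M` has a second moment and positive because
`p > 0`. For `K = Finset.univ` the proportion is always `1`, so the limit is deterministic. -/

/-- The mean of `f` under the binomial distribution with parameters `m` and `p`. -/
noncomputable def binomialMean (p : ℝ) : ℕ → (ℕ → ℝ) → ℝ
  | 0, f => f 0
  | m + 1, f => (1 - p) * binomialMean p m f + p * binomialMean p m (fun j => f (j + 1))

/-! ### Binomial means: linearity, monotonicity, moments. -/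

section BinomialMean

variable {p : ℝ}

lemma binomialMean_const (m : ℕ) (c : ℝ) : binomialMean p m (fun _ => c) = c := by
  induction m with
  | zero => rfl
  | succ m ih => simp only [binomialMean, ih]; ring

lemma binomialMean_add (m : ℕ) (f g : ℕ → ℝ) :
    binomialMean p m (fun j => f j + g j) = binomialMean p m f + binomialMean p m g := by
  induction m generalizing f g with
  | zero => rfl
  | succ m ih => simp only [binomialMean, ih]; ring

lemma binomialMean_const_mul (m : ℕ) (c : ℝ) (f : ℕ → ℝ) :
    binomialMean p m (fun j => c * f j) = c * binomialMean p m f := by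
  induction m generalizing f with
  | zero => rfl
  | succ m ih => simp only [binomialMean, ih]; ring

lemma binomialMean_sub (m : ℕ) (f g : ℕ → ℝ) :
    binomialMean p m (fun j => f j - g j) = binomialMean p m f - binomialMean p m g := by
  have h := binomialMean_add (p := p) m f (fun j => (-1) * g j)
  rw [binomialMean_const_mul] at h
  simpa [sub_eq_add_neg] using h

lemma binomialMean_sum {ι : Type*} (s : Finset ι) (m : ℕ) (f : ι → ℕ → ℝ) :
    binomialMean p m (fun j => ∑ i ∈ s, f i j) = ∑ i ∈ s, binomialMean p m (f i) := by
  classical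
  induction s using Finset.induction_on with
  | empty => simpa using binomialMean_const m 0
  | insert a s ha ih =>
    simp only [Finset.sum_insert ha, ← ih]
    exact binomialMean_add m _ _

lemma binomialMean_congr {m : ℕ} {f g : ℕ → ℝ} (h : ∀ j ≤ m, f j = g j) :
    binomialMean p m f = binomialMean p m g := by
  induction m generalizing f g with
  | zero => exact h 0 le_rfl
  | succ m ih =>
    simp only [binomialMean]
    rw [ih (fun j hj => h j (by omega)), ih (fun j hj => h (j + 1) (by omega))]

lemma binomialMean_mono (hp : p ∈ Set.Icc (0 : ℝ) 1) (m : ℕ) {f g : ℕ → ℝ} (h : ∀ j, f j ≤ g j) :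
    binomialMean p m f ≤ binomialMean p m g := by
  induction m generalizing f g with
  | zero => exact h 0
  | succ m ih =>
    exact add_le_add (mul_le_mul_of_nonneg_left (ih h) (by linarith [hp.2]))
      (mul_le_mul_of_nonneg_left (ih fun j => h (j + 1)) hp.1)

lemma binomialMean_nonneg (hp : p ∈ Set.Icc (0 : ℝ) 1) (m : ℕ) {f : ℕ → ℝ} (h : ∀ j, 0 ≤ f j) :
    0 ≤ binomialMean p m f := by
  simpa [binomialMean_const] using binomialMean_mono hp m (f := fun _ => 0) h

lemma binomialMean_le (hp : p ∈ Set.Icc (0 : ℝ) 1) (m : ℕ) {f : ℕ → ℝ} {c : ℝ}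
    (h : ∀ j, f j ≤ c) : binomialMean p m f ≤ c := by
  simpa [binomialMean_const] using binomialMean_mono hp m (g := fun _ => c) h

lemma abs_binomialMean_le (hp : p ∈ Set.Icc (0 : ℝ) 1) (m : ℕ) (f : ℕ → ℝ) :
    |binomialMean p m f| ≤ binomialMean p m (fun j => |f j|) := by
  refine abs_le.2 ⟨?_, binomialMean_mono hp m fun j => le_abs_self _⟩
  have h := binomialMean_mono hp m (f := fun j => (-1) * |f j|) (g := f)
    fun j => by linarith [neg_abs_le (f j)]
  rw [binomialMean_const_mul] at h
  linarith

lemma binomialMean_id (m : ℕ) : binomialMean p m (fun j => (j : ℝ)) = m * p := by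
  induction m with
  | zero => simp [binomialMean]
  | succ m ih =>
    simp only [binomialMean, Nat.cast_add, Nat.cast_one, binomialMean_add, binomialMean_const, ih]
    ring

lemma binomialMean_mul_pred (m : ℕ) :
    binomialMean p m (fun j => (j : ℝ) * (j - 1)) = m * (m - 1) * p ^ 2 := by
  induction m with
  | zero => simp [binomialMean]
  | succ m ih =>
    have h : (fun j : ℕ => ((j + 1 : ℕ) : ℝ) * ((j + 1 : ℕ) - 1)) =
        fun j : ℕ => (j : ℝ) * (j - 1) + 2 * (j : ℝ) := by
      funext j; push_cast; ring
    simp only [binomialMean, h, binomialMean_add, binomialMean_const_mul, binomialMean_id, ih]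
    push_cast
    ring

lemma binomialMean_mul_succ (m : ℕ) :
    binomialMean p m (fun j => (j : ℝ) * (j + 1)) = m * (m - 1) * p ^ 2 + 2 * (m * p) := by
  rw [← binomialMean_mul_pred, ← binomialMean_id, ← binomialMean_const_mul, ← binomialMean_add]
  congr 1
  funext j
  ring

lemma continuous_binomialMean (m : ℕ) (f : ℕ → ℝ) : Continuous fun p => binomialMean p m f := by
  induction m generalizing f with
  | zero => exact continuous_const
  | succ m ih =>
    exact ((continuous_const.sub continuous_id).mul (ih f)).add
      (continuous_id.mul (ih fun j => f (j + 1)))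

/-- A function is integrated by summing over the atoms `0, …, m`. -/
lemma binomialMean_eq_sum (m : ℕ) (f : ℕ → ℝ) {n : ℕ} (hn : m ≤ n) :
    binomialMean p m f = ∑ l ∈ Finset.range (n + 1),
      f l * binomialMean p m (fun j => if j = l then 1 else 0) := by
  simp only [← binomialMean_const_mul, ← binomialMean_sum]
  refine binomialMean_congr fun j hj => ?_
  simp only [mul_ite, mul_one, mul_zero]
  rw [Finset.sum_ite_eq, if_pos (Finset.mem_range.2 (by omega))]

/-- The number of `i` with `e i ∈ S` is binomial when the `e i` are chosen independently. -/
lemma sum_piFinset_prod_mul {α : Type*} [DecidableEq α] (s : Finset α) (w : α → ℝ)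
    (hw : ∑ a ∈ s, w a = 1) (S : α → Prop) [DecidablePred S] (m : ℕ) (f : ℕ → ℝ) :
    ∑ e ∈ Fintype.piFinset (fun _ : Fin m => s),
        (∏ i, w (e i)) * f (Finset.univ.filter fun i => S (e i)).card =
      binomialMean (∑ a ∈ s.filter S, w a) m f := by
  induction m generalizing f with
  | zero => simp [binomialMean]
  | succ m ih =>
    have hsplit : ∑ a ∈ s.filter (fun a => ¬ S a), w a = 1 - ∑ a ∈ s.filter S, w a := by
      rw [← hw, ← Finset.sum_filter_add_sum_filter_not s S]; ring
    -- Split off the first choice: whether it lies in `S` or not gives the two terms of the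
    -- recursion defining `binomialMean`.
    rw [← Finset.sum_equiv (s := s ×ˢ Fintype.piFinset (fun _ : Fin m => s))
      (f := fun x => (∏ i, w ((Fin.cons x.1 x.2 : Fin (m + 1) → α) i)) *
        f (Finset.univ.filter fun i => S ((Fin.cons x.1 x.2 : Fin (m + 1) → α) i)).card)
      (Fin.consEquiv fun _ : Fin (m + 1) => α)]
    · rw [Finset.sum_product, ← Finset.sum_filter_add_sum_filter_not s S, binomialMean, add_comm,
        ← hsplit, Finset.sum_mul, Finset.sum_mul]
      congr 1
      · refine Finset.sum_congr rfl fun a ha => ?_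
        have ha' := (Finset.mem_filter.1 ha).2
        rw [← ih, Finset.mul_sum]
        refine Finset.sum_congr rfl fun e _ => ?_
        rw [Fin.prod_univ_succ]
        simp only [Fin.cons_zero, Fin.cons_succ, Fin.univ_succ, Finset.filter_cons, ha', if_false,
          Finset.filter_map, Finset.card_map, Function.comp_def,
          Function.Embedding.coeFn_mk, mul_assoc]
      · refine Finset.sum_congr rfl fun a ha => ?_
        have ha' := (Finset.mem_filter.1 ha).2
        rw [← ih, Finset.mul_sum]
        refine Finset.sum_congr rfl fun e _ => ?_
        rw [Fin.prod_univ_succ]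
        simp only [Fin.cons_zero, Fin.cons_succ, Fin.univ_succ, Finset.filter_cons, ha', if_true,
          Finset.filter_map, Finset.card_map, Function.comp_def,
          Function.Embedding.coeFn_mk, mul_assoc, Finset.card_cons]
    · intro x
      simp [Fintype.mem_piFinset, Fin.forall_fin_succ, Fin.consEquiv]
    · intro x _
      rfl

end BinomialMean

/-! ### A supermartingale weight for the urn. -/

/-- The product `∏_{1 ≤ i < n} (1 - 1 / (2 i))`. -/
noncomputable def halfProd (n : ℕ) : ℝ := ∏ i ∈ Finset.Ico 1 n, (1 - 1 / (2 * (i : ℝ)))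

lemma halfProd_succ {n : ℕ} (hn : 1 ≤ n) :
    halfProd (n + 1) = halfProd n * (1 - 1 / (2 * (n : ℝ))) :=
  Finset.prod_Ico_succ_top hn _

lemma halfProd_pos (n : ℕ) : 0 < halfProd n := by
  refine Finset.prod_pos fun i hi => ?_
  have h : (1 : ℝ) ≤ i := by exact_mod_cast (Finset.mem_Ico.1 hi).1
  rw [sub_pos, div_lt_one (by linarith)]
  linarith

lemma halfProd_succ_le {n : ℕ} (hn : 1 ≤ n) : halfProd (n + 1) ≤ halfProd n := by
  rw [halfProd_succ hn]
  exact mul_le_of_le_one_right (halfProd_pos n).le (sub_le_self _ (by positivity))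

/-- Up to the factor `1/2`, this quotient is the drop of `halfProd` from `a + j` to the next
integer. Its monotonicity lets the covariance inequality handle that drop. -/
lemma halfProd_div_antitone {a : ℕ} (ha : 1 ≤ a) :
    Antitone fun j : ℕ => halfProd (a + j) / ((a : ℝ) + j) := by
  refine antitone_nat_of_succ_le fun j => ?_
  have h1 : (1 : ℝ) ≤ a := by exact_mod_cast ha
  refine div_le_div₀ (halfProd_pos _).le (halfProd_succ_le (n := a + j) (by omega)) (by positivity) ?_
  push_cast
  linarith

/-- The covariance of a decreasing function and the identity is nonpositive. -/
lemma binomialMean_mul_sub_nonneg {p : ℝ} (hp : p ∈ Set.Icc (0 : ℝ) 1) (m : ℕ) {f : ℕ → ℝ}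
    (hf : Antitone f) : 0 ≤ binomialMean p m (fun j => f j * (m * p - j)) := by
  have h0 : 0 ≤ (m : ℝ) * p := mul_nonneg (Nat.cast_nonneg _) hp.1
  -- Freezing `f` at the integer part of the mean lowers every value, and the frozen function has
  -- mean zero.
  have h := binomialMean_mono hp m (f := fun j => f ⌊(m : ℝ) * p⌋₊ * (m * p - j))
    (g := fun j => f j * (m * p - j)) fun j => by
      rcases le_or_gt (j : ℝ) (m * p) with hj | hj
      · exact mul_le_mul_of_nonneg_right (hf (Nat.le_floor hj)) (by linarith)
      · exact mul_le_mul_of_nonpos_right (hf ((Nat.floor_lt h0).2 hj).le) (by linarith)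
  rw [binomialMean_const_mul, binomialMean_sub, binomialMean_const, binomialMean_id, sub_self,
    mul_zero] at h
  exact h

/-- This is the one-step inequality behind the supermartingale bound for `halfProd a / halfProd A`.
One more trial multiplies the mean by the factor that takes `halfProd (A + m)` to `halfProd (A + m +
1)`, up to a covariance term of favourable sign, because `a + m * p = p * (A + m)`. -/
lemma binomialMean_halfProd_le {a A : ℕ} (ha : 1 ≤ a) (haA : a ≤ A) (m : ℕ) :
    binomialMean ((a : ℝ) / A) m (fun j => halfProd (a + j)) ≤
      halfProd a / halfProd A * halfProd (A + m) := by
  have ha1 : (1 : ℝ) ≤ a := by exact_mod_cast ha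
  have hA1 : (a : ℝ) ≤ A := by exact_mod_cast haA
  have hA0 : (0 : ℝ) < A := by linarith
  set p : ℝ := (a : ℝ) / A with hpdef
  have hp : p ∈ Set.Icc (0 : ℝ) 1 := ⟨by positivity, (div_le_one hA0).2 hA1⟩
  induction m with
  | zero =>
    simp only [binomialMean, add_zero]
    rw [div_mul_cancel₀ _ (halfProd_pos A).ne']
  | succ m ih =>
    have hAm : (0 : ℝ) < A + m := by positivity
    have key : binomialMean p (m + 1) (fun j => halfProd (a + j)) =
        (1 - 1 / (2 * ((A : ℝ) + m))) * binomialMean p m (fun j => halfProd (a + j)) -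
        1 / (2 * ((A : ℝ) + m)) * binomialMean p m
          (fun j => halfProd (a + j) / ((a : ℝ) + j) * (m * p - j)) := by
      rw [binomialMean, ← binomialMean_const_mul, ← binomialMean_const_mul,
        ← binomialMean_const_mul, ← binomialMean_const_mul, ← binomialMean_add,
        ← binomialMean_sub]
      congr 1
      funext j
      have h1 : halfProd (a + (j + 1)) = halfProd (a + j) * (1 - 1 / (2 * ((a : ℝ) + j))) := by
        rw [← add_assoc, halfProd_succ (by omega)]; push_cast; rfl
      rw [h1, hpdef]
      have : (a : ℝ) + j ≠ 0 := by positivity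
      field_simp
      ring
    have h2 := binomialMean_mul_sub_nonneg hp m (halfProd_div_antitone ha)
    rw [key, ← add_assoc, halfProd_succ (by omega)]
    have h3 : (0 : ℝ) ≤ 1 - 1 / (2 * ((A : ℝ) + m)) := by
      rw [sub_nonneg, div_le_one (by positivity)]
      have : (0 : ℝ) ≤ m := Nat.cast_nonneg _
      linarith
    have h4 := mul_le_mul_of_nonneg_left ih h3
    have h5 : 0 ≤ 1 / (2 * ((A : ℝ) + m)) * binomialMean p m
          (fun j => halfProd (a + j) / ((a : ℝ) + j) * (m * p - j)) := by positivity
    push_cast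
    linarith

/-- A quantitative form of the decay `n ^ (-1/2)`. Raising `A` by one reduces to `(A + 1) * (2 * A -
1) ^ 2 ≤ 4 * A ^ 3`, true for `A ≥ 1`. -/
lemma div_le_halfProd_div_sq {a A : ℕ} (ha : 1 ≤ a) (haA : a ≤ A) :
    (A : ℝ) / a ≤ (halfProd a / halfProd A) ^ 2 := by
  have ha1 : (1 : ℝ) ≤ a := by exact_mod_cast ha
  induction A, haA using Nat.le_induction with
  | base => rw [div_self (by positivity), div_self (halfProd_pos a).ne', one_pow]
  | succ A hA ih =>
    have hA1 : (1 : ℝ) ≤ A := by exact_mod_cast ha.trans hA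
    have hpos := halfProd_pos A
    have h1 : 0 < 1 - 1 / (2 * (A : ℝ)) := by
      rw [sub_pos, div_lt_one (by linarith)]; linarith
    have h2 : ((A : ℝ) + 1) / A ≤ (1 / (1 - 1 / (2 * (A : ℝ)))) ^ 2 := by
      have : 1 / (1 - 1 / (2 * (A : ℝ))) = 2 * A / (2 * A - 1) := by
        have : (2 * (A : ℝ) - 1) ≠ 0 := by linarith
        field_simp
      rw [this, div_pow, div_le_div_iff₀ (by linarith) (by nlinarith)]
      nlinarith
    rw [halfProd_succ (ha.trans hA)]
    calc ((A + 1 : ℕ) : ℝ) / a = (A : ℝ) / a * (((A : ℝ) + 1) / A) := by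
          push_cast; field_simp
      _ ≤ (halfProd a / halfProd A) ^ 2 * (1 / (1 - 1 / (2 * (A : ℝ)))) ^ 2 := by gcongr
      _ = _ := by rw [← mul_pow]; congr 1; field_simp

/-! ### A deterministic stochastic-approximation lemma. -/

/-- Convergence of `X n / (v + n)` for a perturbed linear recursion. -/
lemma tendsto_div_of_recursion {X β γ Δ : ℕ → ℝ} {v : ℕ} {b c : ℝ} (hv : 0 < v)
    (hγ0 : ∀ n, 0 ≤ γ n) (hβ : Tendsto β atTop (𝓝 b)) (hγ : Tendsto γ atTop (𝓝 c))
    (hΔ : Tendsto (fun n : ℕ => (∑ i ∈ Finset.range n, Δ i) / ((v : ℝ) + n)) atTop (𝓝 0))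
    (hX : ∀ n, X (n + 1) = X n + β n - γ n * (X n / ((v : ℝ) + n)) + Δ n) :
    Tendsto (fun n : ℕ => X n / ((v : ℝ) + n)) atTop (𝓝 (b / (1 + c))) := by
  have hc : 0 ≤ c := ge_of_tendsto' hγ hγ0
  have hv' : (0 : ℝ) < v := by exact_mod_cast hv
  have hV : ∀ n : ℕ, (0 : ℝ) < v + n := fun n => by positivity
  set S : ℕ → ℝ := fun n => ∑ i ∈ Finset.range n, Δ i with hS
  set L := b / (1 + c) with hL
  -- Removing the accumulated noise `S` first means that only its sums, not its terms, have to be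
  -- small.
  set e : ℕ → ℝ := fun n => (X n - S n) / ((v : ℝ) + n) - L with he
  set δ : ℕ → ℝ := fun n => β n - (1 + γ n) * L - γ n * (S n / ((v : ℝ) + n)) with hδ
  have hδ0 : Tendsto (fun n => |δ n|) atTop (𝓝 0) := by
    have h : Tendsto δ atTop (𝓝 (b - (1 + c) * L - c * 0)) :=
      (hβ.sub ((tendsto_const_nhds.add hγ).mul tendsto_const_nhds)).sub (hγ.mul hΔ)
    have h0 : b - (1 + c) * L - c * 0 = 0 := by
      rw [hL]; field_simp; ring
    rw [h0] at h
    simpa using h.abs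
  have hrec : ∀ n, ((v : ℝ) + (n + 1 : ℕ)) * e (n + 1) =
      ((v : ℝ) + n - γ n) * e n + δ n := by
    intro n
    have h1 := (hV n).ne'
    have h2 := (hV (n + 1)).ne'
    simp only [he, hδ, hX n, hS, Finset.sum_range_succ]
    push_cast at h2 ⊢
    field_simp
    ring
  -- From here on the factor `v + n - γ n` lies in `[0, v + n]`, so `(v + n) * |e n|` grows by at
  -- most `|δ n|` per step and Cesàro averaging finishes.
  have hlarge : ∀ᶠ n : ℕ in atTop, γ n ≤ (v : ℝ) + n := by
    filter_upwards [hγ.eventually_le_const (lt_add_one c),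
      tendsto_natCast_atTop_atTop.eventually_ge_atTop (c + 1)] with n h1 h2
    linarith
  obtain ⟨n₀, hn₀⟩ := eventually_atTop.1 hlarge
  have hbound : ∀ n ≥ n₀, ((v : ℝ) + n) * |e n| ≤
      ((v : ℝ) + n₀) * |e n₀| + ∑ i ∈ Finset.range n, |δ i| := by
    intro n hn
    induction n, hn using Nat.le_induction with
    | base => exact le_add_of_nonneg_right (Finset.sum_nonneg fun _ _ => abs_nonneg _)
    | succ n hn ih =>
      have h1 : ((v : ℝ) + (n + 1 : ℕ)) * |e (n + 1)| = |((v : ℝ) + n - γ n) * e n + δ n| := by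
        rw [← hrec, abs_mul, abs_of_pos (hV _)]
      have h2 : |((v : ℝ) + n - γ n) * e n| ≤ ((v : ℝ) + n) * |e n| := by
        rw [abs_mul, abs_of_nonneg (by linarith [hn₀ n hn])]
        exact mul_le_mul_of_nonneg_right (by linarith [hγ0 n]) (abs_nonneg _)
      rw [h1, Finset.sum_range_succ]
      linarith [abs_add_le (((v : ℝ) + n - γ n) * e n) (δ n)]
  have he0 : Tendsto e atTop (𝓝 0) := by
    rw [tendsto_zero_iff_abs_tendsto_zero]
    have hup : Tendsto (fun n : ℕ => ((v : ℝ) + n₀) * |e n₀| * (n : ℝ)⁻¹ +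
        (n : ℝ)⁻¹ * ∑ i ∈ Finset.range n, |δ i|) atTop (𝓝 0) := by
      simpa using (tendsto_inv_atTop_nhds_zero_nat (𝕜 := ℝ)).const_mul
        (((v : ℝ) + n₀) * |e n₀|) |>.add hδ0.cesaro
    refine squeeze_zero' (Eventually.of_forall fun n => abs_nonneg _) ?_ hup
    filter_upwards [eventually_ge_atTop n₀, eventually_gt_atTop 0] with n h1 h2
    have h3 : (0 : ℝ) < n := by exact_mod_cast h2
    have h4 : (n : ℝ) * |e n| ≤ ((v : ℝ) + n) * |e n| :=
      mul_le_mul_of_nonneg_right (by linarith) (abs_nonneg _)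
    have h5 := h4.trans (hbound n h1)
    have h6 := mul_le_mul_of_nonneg_left h5 (inv_nonneg.2 h3.le)
    rw [inv_mul_cancel_left₀ h3.ne'] at h6
    simp only [Function.comp]
    linarith
  have h := (he0.add_const L).add hΔ
  simp only [zero_add, add_zero] at h
  refine h.congr fun n => ?_
  simp only [he, hS]
  ring

/-! ### The limiting recursion and its cubic tail. -/

/-- The solution of `(l + 2) x l = 2 q l + (l - 1) x (l - 1)`. -/
noncomputable def degreeLimit (q : ℕ → ℝ) : ℕ → ℝ
  | 0 => q 0
  | l + 1 => (2 * q (l + 1) + l * degreeLimit q l) / (l + 3)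

section DegreeLimit

variable {q : ℕ → ℝ}

lemma degreeLimit_nonneg (hq : ∀ l, 0 ≤ q l) (l : ℕ) : 0 ≤ degreeLimit q l := by
  induction l with
  | zero => exact hq 0
  | succ l ih => have := hq (l + 1); simp only [degreeLimit]; positivity

/-- The factor `l * (l + 1)` is the integrating factor that makes the recursion telescope. -/
lemma degreeLimit_mul (l : ℕ) :
    (l : ℝ) * (l + 1) * (l + 2) * degreeLimit q l =
      2 * ∑ j ∈ Finset.range (l + 1), (j : ℝ) * (j + 1) * q j := by
  induction l with
  | zero => simp
  | succ l ih =>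
    rw [Finset.sum_range_succ, mul_add (2 : ℝ), ← ih, degreeLimit]
    push_cast
    field_simp
    ring

/-- Written as `2 x l + (l x l - (l - 1) x (l - 1)) = 2 q l`, the recursion telescopes without any
factor. The boundary term `n x n` is all that separates the total masses. -/
lemma sum_degreeLimit (n : ℕ) :
    2 * ∑ l ∈ Finset.range (n + 1), degreeLimit q l + n * degreeLimit q n =
      2 * ∑ l ∈ Finset.range (n + 1), q l := by
  induction n with
  | zero => simp [degreeLimit]
  | succ n ih =>
    rw [Finset.sum_range_succ, Finset.sum_range_succ _ (n + 1), mul_add, mul_add, ← ih,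
      degreeLimit]
    push_cast
    field_simp
    ring

lemma tendsto_degreeLimit_mul_cube {c : ℝ}
    (hc : HasSum (fun l : ℕ => (l : ℝ) * (l + 1) * q l) c) :
    Tendsto (fun l : ℕ => degreeLimit q l * (l : ℝ) ^ 3) atTop (𝓝 (2 * c)) := by
  have h1 : Tendsto (fun l : ℕ => 2 * ∑ j ∈ Finset.range (l + 1), (j : ℝ) * (j + 1) * q j)
      atTop (𝓝 (2 * c)) :=
    ((tendsto_add_atTop_iff_nat 1).2 hc.tendsto_sum_nat).const_mul 2
  have h0 := tendsto_inv_atTop_nhds_zero_nat (𝕜 := ℝ)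
  have h2 : Tendsto (fun l : ℕ => ((1 + (l : ℝ)⁻¹) * (1 + 2 * (l : ℝ)⁻¹))⁻¹) atTop (𝓝 1) := by
    have := ((h0.const_add 1).mul ((h0.const_mul 2).const_add 1)).inv₀ (by norm_num)
    simpa using this
  have h := h1.mul h2
  rw [mul_one] at h
  refine h.congr' ?_
  filter_upwards [eventually_gt_atTop 0] with l hl
  have hl' : (0 : ℝ) < l := by exact_mod_cast hl
  rw [← degreeLimit_mul]
  field_simp

lemma hasSum_degreeLimit {c : ℝ} (hq : ∀ l, 0 ≤ q l) (h1 : HasSum q 1)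
    (hc : HasSum (fun l : ℕ => (l : ℝ) * (l + 1) * q l) c) : HasSum (degreeLimit q) 1 := by
  rw [hasSum_iff_tendsto_nat_of_nonneg (degreeLimit_nonneg hq), ← tendsto_add_atTop_iff_nat 1]
  have h0 := tendsto_inv_atTop_nhds_zero_nat (𝕜 := ℝ)
  -- The cubic tail makes the boundary term of `sum_degreeLimit` vanish.
  have hz : Tendsto (fun n : ℕ => (n : ℝ) * degreeLimit q n) atTop (𝓝 0) := by
    have := ((tendsto_degreeLimit_mul_cube hc).mul (h0.pow 2))
    simp only [ne_eq, OfNat.ofNat_ne_zero, not_false_eq_true, zero_pow, mul_zero] at this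
    refine this.congr' ?_
    filter_upwards [eventually_gt_atTop 0] with l hl
    have hl' : (0 : ℝ) < l := by exact_mod_cast hl
    field_simp
  have h2 := ((tendsto_add_atTop_iff_nat 1).2 h1.tendsto_sum_nat).sub (hz.const_mul (1 / 2))
  simp only [mul_zero, sub_zero] at h2
  refine h2.congr fun n => ?_
  linarith [sum_degreeLimit (q := q) n]

end DegreeLimit

/-! ### Degrees, edge counts and attachment probabilities for a set of types. -/

lemma Multiset.sum_countP_and {α ι : Type*} [DecidableEq ι] (s : Multiset α) (p : α → Prop)
    [DecidablePred p] (f : α → ι) (K : Finset ι) :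
    ∑ k ∈ K, s.countP (fun a => p a ∧ f a = k) = s.countP (fun a => p a ∧ f a ∈ K) := by
  induction s using Multiset.induction_on with
  | empty => simp
  | cons a s ih =>
    simp only [Multiset.countP_cons, Finset.sum_add_distrib, ih]
    congr 1
    by_cases h : p a <;> simp [h]

namespace TypedMultigraph

variable {N : ℕ} (G : TypedMultigraph N) (K : Finset (Fin N))

/-- The number of edges at `v` whose type lies in `K`. -/
def degreeIn (v : ℕ) : ℕ := ∑ k ∈ K, G.typeDegree k v

/-- The number of edges whose type lies in `K`. -/
def numEdgesIn : ℕ := ∑ k ∈ K, G.numEdges k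

/-- The number of vertices at which exactly `l` edges have a type in `K`. -/
def countDegreeIn (l : ℕ) : ℕ :=
  ((Finset.range G.numVertices).filter (fun v => G.degreeIn K v = l)).card

/-- The proportion of the edges whose type lies in `K`. -/
noncomputable def proportion : ℝ := (G.numEdgesIn K : ℝ) / G.numEdgesIn Finset.univ

lemma degreeIn_eq_countP (v : ℕ) :
    G.degreeIn K v = G.edges.countP (fun e => v ∈ e.1 ∧ e.2 ∈ K) :=
  Multiset.sum_countP_and G.edges (fun e => v ∈ e.1) Prod.snd K

lemma numEdgesIn_eq_countP : G.numEdgesIn K = G.edges.countP (fun e => e.2 ∈ K) := by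
  simpa [numEdgesIn, numEdges] using Multiset.sum_countP_and G.edges (fun _ => True) Prod.snd K

lemma numEdgesIn_univ : G.numEdgesIn Finset.univ = Multiset.card G.edges := by
  rw [numEdgesIn_eq_countP, Multiset.countP_eq_card]
  simp

lemma numEdgesIn_le : G.numEdgesIn K ≤ G.numEdgesIn Finset.univ := by
  rw [numEdgesIn_univ, numEdgesIn_eq_countP]
  exact Multiset.countP_le_card _ _

lemma card_filter_mem_sym2 {e : Sym2 ℕ} {n : ℕ} (he : ¬ e.IsDiag) (hn : ∀ v ∈ e, v < n) :
    ((Finset.range n).filter (fun v => v ∈ e)).card = 2 := by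
  induction e using Sym2.ind with
  | _ a b =>
    have hab : a ≠ b := by simpa using he
    rw [← Finset.card_pair hab]
    congr 1
    ext v
    simp only [Finset.mem_filter, Finset.mem_range, Sym2.mem_iff, Finset.mem_insert,
      Finset.mem_singleton, and_iff_right_iff_imp]
    exact fun h => hn v (by simpa using h)

/-- Handshake lemma: since there are no loops, each edge is counted at exactly two vertices. -/
lemma sum_degreeIn :
    ∑ v ∈ Finset.range G.numVertices, G.degreeIn K v = 2 * G.numEdgesIn K := by
  simp only [degreeIn_eq_countP, numEdgesIn_eq_countP]
  have h1 := G.mem_vertices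
  have h2 := G.loopless
  generalize G.edges = s at h1 h2 ⊢
  induction s using Multiset.induction_on with
  | empty => simp
  | cons e s ih =>
    simp only [Multiset.countP_cons, Finset.sum_add_distrib]
    rw [ih (fun e he => h1 e (Multiset.mem_cons_of_mem he))
      (fun e he => h2 e (Multiset.mem_cons_of_mem he)), mul_add]
    congr 1
    by_cases h : e.2 ∈ K
    · simpa [h] using card_filter_mem_sym2 (h2 e (Multiset.mem_cons_self _ _))
        (h1 e (Multiset.mem_cons_self _ _))
    · simp [h]

lemma degreeIn_eq_zero {v : ℕ} (hv : G.numVertices ≤ v) : G.degreeIn K v = 0 := by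
  rw [degreeIn_eq_countP, Multiset.countP_eq_zero]
  rintro e he ⟨h, -⟩
  exact absurd (G.mem_vertices e he v h) (by omega)

lemma degreeIn_le (v : ℕ) : G.degreeIn K v ≤ 2 * G.numEdgesIn K := by
  rcases lt_or_ge v G.numVertices with hv | hv
  · rw [← sum_degreeIn]
    exact Finset.single_le_sum (f := fun v => G.degreeIn K v) (fun _ _ => Nat.zero_le _)
      (Finset.mem_range.2 hv)
  · simp [degreeIn_eq_zero G K hv]

/-- The degree of `v` cancels: the two-stage choice is the uniform choice of a half-edge. -/
lemma attachProb_eq (v : ℕ) (k : Fin N) :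
    G.attachProb v k = (G.typeDegree k v : ℝ) / (2 * G.numEdgesIn Finset.univ) := by
  have hsum : ∑ u ∈ Finset.range G.numVertices, (G.degree u : ℝ) =
      2 * G.numEdgesIn Finset.univ := by
    exact_mod_cast G.sum_degreeIn Finset.univ
  rw [attachProb, hsum]
  -- At an isolated vertex the quotient `0 / 0` is `0`, in agreement with the vanishing type degree.
  rcases eq_or_ne (G.degree v) 0 with h | h
  · have : G.typeDegree k v = 0 := (Finset.sum_eq_zero_iff.1 h) k (Finset.mem_univ k)
    simp [this]
  · have : (G.degree v : ℝ) ≠ 0 := by exact_mod_cast h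
    field_simp

lemma sum_attachProb (v : ℕ) :
    ∑ k ∈ K, G.attachProb v k = (G.degreeIn K v : ℝ) / (2 * G.numEdgesIn Finset.univ) := by
  simp only [attachProb_eq, ← Finset.sum_div, degreeIn]
  push_cast
  rfl

lemma sum_sum_attachProb :
    ∑ v ∈ Finset.range G.numVertices, ∑ k ∈ K, G.attachProb v k = G.proportion K := by
  simp only [sum_attachProb, ← Finset.sum_div]
  rw [proportion, ← Nat.cast_sum, sum_degreeIn]
  push_cast
  exact mul_div_mul_left _ _ two_ne_zero

lemma attachProb_mem_Icc (v : ℕ) (k : Fin N) : G.attachProb v k ∈ Set.Icc (0 : ℝ) 1 := by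
  rw [attachProb_eq]
  refine ⟨by positivity, div_le_one_of_le₀ ?_ (by positivity)⟩
  have h1 : G.typeDegree k v ≤ G.degreeIn Finset.univ v :=
    Finset.single_le_sum (f := fun k => G.typeDegree k v) (fun _ _ => Nat.zero_le _)
      (Finset.mem_univ k)
  exact_mod_cast h1.trans (G.degreeIn_le Finset.univ v)

lemma proportion_mem_Icc : G.proportion K ∈ Set.Icc (0 : ℝ) 1 :=
  ⟨by rw [proportion]; positivity,
    div_le_one_of_le₀ (by exact_mod_cast G.numEdgesIn_le K) (by positivity)⟩

lemma sum_ite_degreeIn (l : ℕ) :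
    ∑ v ∈ Finset.range G.numVertices, (if G.degreeIn K v = l then (1 : ℝ) else 0) =
      G.countDegreeIn K l := by
  rw [Finset.sum_boole, countDegreeIn]

/-- The probability that a new edge has its old endpoint and its type in `S`. -/
noncomputable def attachMass (S : ℕ × Fin N → Prop) [DecidablePred S] : ℝ :=
  ∑ e ∈ (Finset.range G.numVertices ×ˢ Finset.univ).filter S, G.attachProb e.1 e.2

lemma attachMass_snd_mem : G.attachMass (fun e => e.2 ∈ K) = G.proportion K := by
  rw [← sum_sum_attachProb, attachMass, Finset.sum_filter, Finset.sum_product]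
  refine Finset.sum_congr rfl fun v _ => ?_
  simp [Finset.sum_ite_mem]

lemma attachMass_fst_eq {v : ℕ} (hv : v < G.numVertices) :
    G.attachMass (fun e => e.1 = v ∧ e.2 ∈ K) =
      (G.degreeIn K v : ℝ) / (2 * G.numEdgesIn Finset.univ) := by
  rw [← sum_attachProb, attachMass, Finset.sum_filter, Finset.sum_product,
    Finset.sum_eq_single_of_mem v (Finset.mem_range.2 hv)]
  · simp [Finset.sum_ite_mem]
  · intro u _ huv
    simp [huv]

lemma sum_attachProb_product (h : 0 < G.numEdgesIn Finset.univ) :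
    ∑ e ∈ Finset.range G.numVertices ×ˢ (Finset.univ : Finset (Fin N)), G.attachProb e.1 e.2
      = 1 := by
  rw [Finset.sum_product, sum_sum_attachProb, proportion, div_self]
  exact_mod_cast h.ne'

lemma attachMass_mem_Icc (S : ℕ × Fin N → Prop) [DecidablePred S] :
    G.attachMass S ∈ Set.Icc (0 : ℝ) 1 := by
  have h0 : ∀ e : ℕ × Fin N, 0 ≤ G.attachProb e.1 e.2 := fun e => (G.attachProb_mem_Icc _ _).1
  refine ⟨Finset.sum_nonneg fun e _ => h0 e, ?_⟩
  refine (Finset.sum_le_sum_of_subset_of_nonneg (Finset.filter_subset _ _)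
    fun e _ _ => h0 e).trans ?_
  rw [Finset.sum_product, sum_sum_attachProb]
  exact (G.proportion_mem_Icc _).2

end TypedMultigraph

/-! ### Pathwise description of one step. -/

/-- The number of edges added in step `n + 1` whose old endpoint and type lie in `S`. -/
def hits {Ω : Type*} {N : ℕ} (M : ℕ → Ω → ℕ) (Y : ℕ → ℕ → Ω → ℕ) (T : ℕ → ℕ → Ω → Fin N)
    (n : ℕ) (S : ℕ × Fin N → Prop) [DecidablePred S] (ω : Ω) : ℕ :=
  ((Finset.range (M (n + 1) ω)).filter fun i => S (Y (n + 1) i ω, T (n + 1) i ω)).card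

lemma hits_le {Ω : Type*} {N : ℕ} (M : ℕ → Ω → ℕ) (Y : ℕ → ℕ → Ω → ℕ) (T : ℕ → ℕ → Ω → Fin N) (n : ℕ)
    (S : ℕ × Fin N → Prop) [DecidablePred S] (ω : Ω) : hits M Y T n S ω ≤ M (n + 1) ω :=
  (Finset.card_filter_le _ _).trans (Finset.card_range _).le

lemma countP_newEdges {Ω : Type*} {N : ℕ} (M : ℕ → Ω → ℕ) (Y : ℕ → ℕ → Ω → ℕ)
    (T : ℕ → ℕ → Ω → Fin N) (n : ℕ) (ω : Ω) (c : ℕ) (P : Sym2 ℕ × Fin N → Prop)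
    [DecidablePred P] (S : ℕ × Fin N → Prop) [DecidablePred S]
    (h : ∀ i < M (n + 1) ω, P (s(c, Y (n + 1) i ω), T (n + 1) i ω) ↔
      S (Y (n + 1) i ω, T (n + 1) i ω)) :
    ((Multiset.range (M (n + 1) ω)).map
      (fun i => (s(c, Y (n + 1) i ω), T (n + 1) i ω))).countP P = hits M Y T n S ω := by
  rw [Multiset.countP_map, hits, Finset.card_def, Finset.filter_val, Finset.range_val]
  congr 1
  exact Multiset.filter_congr fun i hi => h i (Multiset.mem_range.1 hi)

namespace IsGenBarabasiAlbert

open TypedMultigraph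

variable {Ω : Type*} [MeasurableSpace Ω] {μ : Measure Ω} {N : ℕ} {G₀ : TypedMultigraph N}
  {M : ℕ → Ω → ℕ} {Y : ℕ → ℕ → Ω → ℕ} {T : ℕ → ℕ → Ω → Fin N} {G : ℕ → Ω → TypedMultigraph N}

lemma numVertices_eq (hG : IsGenBarabasiAlbert μ G₀ M Y T G) (n : ℕ) (ω : Ω) :
    (G n ω).numVertices = G₀.numVertices + n := by
  induction n with
  | zero => rw [hG.init, add_zero]
  | succ n ih => rw [hG.numVertices_succ, ih, add_assoc]

/-- The new graph is itself a loopless multigraph on one more vertex: its bound on labels, together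
with the absence of a loop at the new vertex, forces the endpoint to be old. -/
lemma endpoint_lt (hG : IsGenBarabasiAlbert μ G₀ M Y T G) (n : ℕ) (ω : Ω) {i : ℕ}
    (hi : i < M (n + 1) ω) : Y (n + 1) i ω < (G n ω).numVertices := by
  have hmem : (s((G n ω).numVertices, Y (n + 1) i ω), T (n + 1) i ω) ∈ (G (n + 1) ω).edges := by
    rw [hG.edges_succ]
    exact Multiset.mem_add.2 (Or.inr (Multiset.mem_map.2 ⟨i, Multiset.mem_range.2 hi, rfl⟩))
  have h1 := (G (n + 1) ω).mem_vertices _ hmem (Y (n + 1) i ω) (by simp)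
  have h2 := (G (n + 1) ω).loopless _ hmem
  rw [hG.numVertices_succ] at h1
  simp only [Sym2.mk_isDiag_iff] at h2
  omega

lemma degreeIn_succ_of_lt (hG : IsGenBarabasiAlbert μ G₀ M Y T G) (K : Finset (Fin N)) (n : ℕ)
    (ω : Ω) {v : ℕ} (hv : v < (G n ω).numVertices) :
    (G (n + 1) ω).degreeIn K v =
      (G n ω).degreeIn K v + hits M Y T n (fun e => e.1 = v ∧ e.2 ∈ K) ω := by
  rw [degreeIn_eq_countP, degreeIn_eq_countP, hG.edges_succ, Multiset.countP_add,
   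
    countP_newEdges M Y T n ω _ _ (fun e => e.1 = v ∧ e.2 ∈ K)]
  intro i _
  simp only [Sym2.mem_iff]
  constructor
  · rintro ⟨h | h, h'⟩
    · omega
    · exact ⟨h.symm, h'⟩
  · rintro ⟨h, h'⟩
    exact ⟨Or.inr h.symm, h'⟩

lemma degreeIn_succ_new (hG : IsGenBarabasiAlbert μ G₀ M Y T G) (K : Finset (Fin N)) (n : ℕ)
    (ω : Ω) :
    (G (n + 1) ω).degreeIn K (G n ω).numVertices = hits M Y T n (fun e => e.2 ∈ K) ω := by
  have h0 := degreeIn_eq_zero (G n ω) K le_rfl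
  rw [degreeIn_eq_countP] at h0 ⊢
  rw [hG.edges_succ, Multiset.countP_add, h0, zero_add,
    countP_newEdges M Y T n ω _ _ (fun e => e.2 ∈ K)]
  intro i _
  simp

lemma numEdgesIn_succ (hG : IsGenBarabasiAlbert μ G₀ M Y T G) (K : Finset (Fin N)) (n : ℕ)
    (ω : Ω) :
    (G (n + 1) ω).numEdgesIn K = (G n ω).numEdgesIn K + hits M Y T n (fun e => e.2 ∈ K) ω := by
  rw [numEdgesIn_eq_countP, numEdgesIn_eq_countP, hG.edges_succ, Multiset.countP_add,
    countP_newEdges M Y T n ω _ _ (fun e => e.2 ∈ K)]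
  intro i _
  rfl

lemma numEdgesIn_univ_succ (hG : IsGenBarabasiAlbert μ G₀ M Y T G) (n : ℕ) (ω : Ω) :
    (G (n + 1) ω).numEdgesIn Finset.univ =
      (G n ω).numEdgesIn Finset.univ + M (n + 1) ω := by
  rw [numEdgesIn_univ, numEdgesIn_univ, hG.edges_succ]
  simp

lemma numEdgesIn_pos (hG : IsGenBarabasiAlbert μ G₀ M Y T G) {K : Finset (Fin N)}
    (hK : K.Nonempty) (n : ℕ) (ω : Ω) : 0 < (G n ω).numEdgesIn K := by
  induction n with
  | zero =>
    rw [hG.init]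
    exact Finset.sum_pos (fun k _ => hG.numEdges_pos k) hK
  | succ n ih => rw [hG.numEdgesIn_succ]; omega

lemma numEdgesIn_univ_pos (hG : IsGenBarabasiAlbert μ G₀ M Y T G) (n : ℕ) (ω : Ω) :
    0 < (G n ω).numEdgesIn Finset.univ :=
  hG.numEdgesIn_pos ⟨T 0 0 ω, Finset.mem_univ _⟩ n ω

lemma sum_hits (hG : IsGenBarabasiAlbert μ G₀ M Y T G) (K : Finset (Fin N)) (n : ℕ) (ω : Ω) :
    ∑ v ∈ Finset.range (G n ω).numVertices, hits M Y T n (fun e => e.1 = v ∧ e.2 ∈ K) ω =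
      hits M Y T n (fun e => e.2 ∈ K) ω := by
  simp only [hits]
  rw [Finset.card_eq_sum_card_fiberwise (f := fun i => Y (n + 1) i ω)
    (t := Finset.range (G n ω).numVertices)]
  · refine Finset.sum_congr rfl fun v _ => ?_
    rw [Finset.filter_filter]
    simp only [and_comm]
  · intro i hi
    have hi' : i < M (n + 1) ω := by
      simpa using (Finset.mem_filter.1 (Finset.mem_coe.1 hi)).1
    exact Finset.mem_coe.2 (Finset.mem_range.2 (hG.endpoint_lt n ω hi'))

/-- The vertex counts in step `n + 1` in terms of the graph in step `n` and the new edges. -/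
lemma countDegreeIn_succ (hG : IsGenBarabasiAlbert μ G₀ M Y T G) (K : Finset (Fin N)) (l n : ℕ)
    (ω : Ω) :
    ((G (n + 1) ω).countDegreeIn K l : ℝ) =
      (if hits M Y T n (fun e => e.2 ∈ K) ω = l then 1 else 0) +
      ∑ v ∈ Finset.range (G₀.numVertices + n),
        if (G n ω).degreeIn K v + hits M Y T n (fun e => e.1 = v ∧ e.2 ∈ K) ω = l
          then 1 else 0 := by
  rw [← sum_ite_degreeIn, hG.numVertices_succ, Finset.sum_range_succ, hG.degreeIn_succ_new,
    add_comm, ← hG.numVertices_eq n ω]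
  congr 1
  refine Finset.sum_congr rfl fun v hv => ?_
  rw [hG.degreeIn_succ_of_lt K n ω (Finset.mem_range.1 hv)]

/-- Only vertices hit by a new edge change their degree, and there are at most `M (n + 1)` of them;
the `1` is for the new vertex. This bound controls the martingale differences in `L²`. -/
lemma abs_countDegreeIn_succ_sub_le (hG : IsGenBarabasiAlbert μ G₀ M Y T G) (K : Finset (Fin N))
    (l n : ℕ) (ω : Ω) :
    |((G (n + 1) ω).countDegreeIn K l : ℝ) - (G n ω).countDegreeIn K l| ≤
      1 + (M (n + 1) ω : ℝ) := by
  have h1 : ((G (n + 1) ω).countDegreeIn K l : ℝ) - (G n ω).countDegreeIn K l =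
      (if hits M Y T n (fun e => e.2 ∈ K) ω = l then 1 else 0) +
      ∑ v ∈ Finset.range (G n ω).numVertices,
        ((if (G n ω).degreeIn K v + hits M Y T n (fun e => e.1 = v ∧ e.2 ∈ K) ω = l
          then 1 else 0) - (if (G n ω).degreeIn K v = l then (1 : ℝ) else 0)) := by
    rw [hG.countDegreeIn_succ, Finset.sum_sub_distrib, sum_ite_degreeIn, hG.numVertices_eq]
    ring
  rw [h1]
  refine (abs_add_le _ _).trans (add_le_add ?_ ?_)
  · split_ifs <;> simp
  · refine (Finset.abs_sum_le_sum_abs _ _).trans ?_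
    have h2 : (hits M Y T n (fun e => e.2 ∈ K) ω : ℝ) ≤ M (n + 1) ω := by
      exact_mod_cast hits_le M Y T n _ ω
    refine le_trans ?_ h2
    rw [← hG.sum_hits, Nat.cast_sum]
    refine Finset.sum_le_sum fun v _ => ?_
    rcases Nat.eq_zero_or_pos (hits M Y T n (fun e => e.1 = v ∧ e.2 ∈ K) ω) with h | h
    · simp [h]
    · have h' : (1 : ℝ) ≤ hits M Y T n (fun e => e.1 = v ∧ e.2 ∈ K) ω := by exact_mod_cast h
      refine le_trans ?_ h'
      split_ifs <;> simp

end IsGenBarabasiAlbert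

/-! ### The conditional law of one step. -/

namespace IsGenBarabasiAlbert

open TypedMultigraph

lemma measurable_comp_graph {Ω β : Type*} [MeasurableSpace β] {N : ℕ}
    {G : ℕ → Ω → TypedMultigraph N} (f : TypedMultigraph N → β) (n : ℕ) :
    Measurable[graphHistory G n] fun ω => f (G n ω) := by
  have h : Measurable[graphHistory G n] (G n) :=
    measurable_iff_comap_le.2 (le_iSup₂ (f := fun i (_ : i ≤ n) =>
      MeasurableSpace.comap (G i) ⊤) n le_rfl)
  exact Measurable.comp (measurable_from_top (f := f)) h

lemma newEdges_eq_iff {Ω : Type*} {N : ℕ} {M : ℕ → Ω → ℕ} {Y : ℕ → ℕ → Ω → ℕ}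
    {T : ℕ → ℕ → Ω → Fin N} (n m : ℕ) (e : Fin m → ℕ × Fin N) (ω : Ω) :
    (M (n + 1) ω = m ∧ ∀ i : Fin m, Y (n + 1) i ω = (e i).1 ∧ T (n + 1) i ω = (e i).2) ↔
      M (n + 1) ω = m ∧ e = fun i : Fin m => (Y (n + 1) i ω, T (n + 1) i ω) := by
  simp only [funext_iff, Prod.ext_iff]
  exact and_congr_right fun _ => forall_congr' fun i => and_congr eq_comm eq_comm

variable {Ω : Type*} [MeasurableSpace Ω] {μ : Measure Ω} {N : ℕ} {G₀ : TypedMultigraph N}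
  {M : ℕ → Ω → ℕ} {Y : ℕ → ℕ → Ω → ℕ} {T : ℕ → ℕ → Ω → Fin N} {G : ℕ → Ω → TypedMultigraph N}

lemma graphHistory_le (hG : IsGenBarabasiAlbert μ G₀ M Y T G) (n : ℕ) :
    graphHistory G n ≤ ‹MeasurableSpace Ω› :=
  iSup₂_le fun i _ => (hG.measurable_G i).comap_le

/-- The filtration of the graph process. -/
def filtration (hG : IsGenBarabasiAlbert μ G₀ M Y T G) : Filtration ℕ ‹MeasurableSpace Ω› where
  seq := graphHistory G
  mono' _ _ hij := biSup_mono fun _ hk => hk.trans hij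
  le' := hG.graphHistory_le

lemma measurable_comp_graph' (hG : IsGenBarabasiAlbert μ G₀ M Y T G) {β : Type*}
    [MeasurableSpace β] (f : TypedMultigraph N → β) (n : ℕ) : Measurable fun ω => f (G n ω) :=
  (measurable_comp_graph f n).mono (hG.graphHistory_le n) le_rfl

lemma measurable_hits (hG : IsGenBarabasiAlbert μ G₀ M Y T G) (n : ℕ) (S : ℕ × Fin N → Prop)
    [DecidablePred S] : Measurable (hits M Y T n S) := by
  have h : Measurable fun x : ℕ × Ω =>
      ((Finset.range x.1).filter fun i => S (Y (n + 1) i x.2, T (n + 1) i x.2)).card := by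
    refine measurable_from_prod_countable_right fun m => ?_
    simp only [Finset.card_filter]
    refine Finset.measurable_sum _ fun i _ => ?_
    have hS : Measurable fun e : ℕ × Fin N => if S e then 1 else 0 := measurable_of_countable _
    exact hS.comp ((hG.measurable_Y n i).prodMk (hG.measurable_T n i))
  exact h.comp ((hG.measurable_M n).prodMk measurable_id)

lemma measurable_comp_step (hG : IsGenBarabasiAlbert μ G₀ M Y T G) (n : ℕ)
    (S : ℕ × Fin N → Prop) [DecidablePred S] {β : Type*} [MeasurableSpace β]
    (Φ : TypedMultigraph N → ℕ → ℕ → β) :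
    Measurable fun ω => Φ (G n ω) (M (n + 1) ω) (hits M Y T n S ω) := by
  have h : Measurable fun x : TypedMultigraph N × (ℕ × ℕ) => Φ x.1 x.2.1 x.2.2 :=
    measurable_from_prod_countable_left fun y => measurable_from_top
  exact h.comp ((hG.measurable_G n).prodMk ((hG.measurable_M n).prodMk (hG.measurable_hits n S)))

lemma measurableSet_newEdges (hG : IsGenBarabasiAlbert μ G₀ M Y T G) (n m : ℕ)
    (e : Fin m → ℕ × Fin N) :
    MeasurableSet {ω | M (n + 1) ω = m ∧
      ∀ i : Fin m, Y (n + 1) i ω = (e i).1 ∧ T (n + 1) i ω = (e i).2} := by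
  refine measurableSet_setOfPred.2 ?_
  refine Measurable.and (measurableSet_setOfPred.1 (hG.measurable_M n (measurableSet_singleton m)))
    (Measurable.forall fun i => Measurable.and ?_ ?_)
  · exact measurableSet_setOfPred.1 (hG.measurable_Y n i (measurableSet_singleton _))
  · exact measurableSet_setOfPred.1 (hG.measurable_T n i (measurableSet_singleton _))

lemma prod_attachProb_mem_Icc (g : TypedMultigraph N) {m : ℕ} (e : Fin m → ℕ × Fin N) :
    ∏ i, g.attachProb (e i).1 (e i).2 ∈ Set.Icc (0 : ℝ) 1 :=
  ⟨Finset.prod_nonneg fun _ _ => (g.attachProb_mem_Icc _ _).1,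
    Finset.prod_le_one (fun _ _ => (g.attachProb_mem_Icc _ _).1)
      fun _ _ => (g.attachProb_mem_Icc _ _).2⟩

/-- Integrating `attach` over an event of the past leaves the indicator of `M (n + 1) = m` times a
function of the old graph; `indep_M` then factors out the probability of that event. -/
lemma measure_inter_newEdges [IsProbabilityMeasure μ] (hG : IsGenBarabasiAlbert μ G₀ M Y T G)
    (n m : ℕ) (e : Fin m → ℕ × Fin N) {A : Set Ω} (hA : MeasurableSet[graphHistory G n] A) :
    μ (A ∩ {ω | M (n + 1) ω = m ∧
        ∀ i : Fin m, Y (n + 1) i ω = (e i).1 ∧ T (n + 1) i ω = (e i).2}) =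
      ∫⁻ ω in A, μ {ω | M (n + 1) ω = m} *
        ENNReal.ofReal (∏ i, (G n ω).attachProb (e i).1 (e i).2) ∂μ := by
  have hle := hG.graphHistory_le n
  have hleM : MeasurableSpace.comap (M (n + 1)) ⊤ ≤ ‹MeasurableSpace Ω› :=
    (hG.measurable_M n).comap_le
  have hle' := sup_le hle hleM
  have hA0 := hle A hA
  have hD := hG.measurableSet_newEdges n m e
  set D := {ω | M (n + 1) ω = m ∧
        ∀ i : Fin m, Y (n + 1) i ω = (e i).1 ∧ T (n + 1) i ω = (e i).2}
  set W : Ω → ℝ := fun ω => ∏ i, (G n ω).attachProb (e i).1 (e i).2 with hW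
  have hWm : Measurable[graphHistory G n] W :=
    measurable_comp_graph (fun g => ∏ i, g.attachProb (e i).1 (e i).2) n
  have hMm : MeasurableSet {ω | M (n + 1) ω = m} := hG.measurable_M n (measurableSet_singleton m)
  have hVm : Measurable fun ω => if M (n + 1) ω = m then W ω else 0 :=
    Measurable.ite hMm (hWm.mono hle le_rfl) measurable_const
  have hV0 : ∀ ω, 0 ≤ if M (n + 1) ω = m then W ω else 0 := fun ω => by
    split_ifs
    exacts [(prod_attachProb_mem_Icc _ e).1, le_rfl]
  have hVint : Integrable (fun ω => if M (n + 1) ω = m then W ω else 0) μ := by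
    refine Integrable.of_bound hVm.aestronglyMeasurable 1 (Eventually.of_forall fun ω => ?_)
    rw [Real.norm_of_nonneg (hV0 ω)]
    split_ifs
    exacts [(prod_attachProb_mem_Icc _ e).2, zero_le_one]
  have h1 := setIntegral_condExp hle' ((integrable_const (1 : ℝ)).indicator hD (μ := μ))
    (le_sup_left (a := graphHistory G n) (b := MeasurableSpace.comap (M (n + 1)) ⊤) A hA)
  have h2 := hG.attach n m (fun i => (e i).1) (fun i => (e i).2)
  rw [setIntegral_congr_ae hA0 (h2.mono fun ω h _ => h), setIntegral_indicator hD,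
    setIntegral_const, smul_eq_mul, mul_one] at h1
  calc μ (A ∩ D) = ENNReal.ofReal (μ.real (A ∩ D)) := (ofReal_measureReal).symm
    _ = ∫⁻ ω in A, ENNReal.ofReal (if M (n + 1) ω = m then W ω else 0) ∂μ := by
      rw [← h1, ofReal_integral_eq_lintegral_ofReal hVint.restrict
        (Eventually.of_forall hV0)]
    _ = ∫⁻ ω, {ω | M (n + 1) ω = m}.indicator (fun _ => 1) ω *
          A.indicator (fun ω => ENNReal.ofReal (W ω)) ω ∂μ := by
      rw [← lintegral_indicator hA0]
      refine lintegral_congr fun ω => ?_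
      by_cases h : ω ∈ A <;> by_cases h' : M (n + 1) ω = m <;> simp [h, h']
    _ = μ {ω | M (n + 1) ω = m} * ∫⁻ ω in A, ENNReal.ofReal (W ω) ∂μ := by
      rw [lintegral_mul_eq_lintegral_mul_lintegral_of_independent_measurableSpace hleM hle
        (hG.indep_M n), lintegral_indicator hMm, lintegral_indicator hA0, lintegral_one,
        Measure.restrict_apply_univ]
      · exact Measurable.indicator measurable_const ⟨{m}, trivial, rfl⟩
      · exact Measurable.indicator (ENNReal.measurable_ofReal.comp hWm) hA
    _ = _ := by
      exact (lintegral_const_mul _ (ENNReal.measurable_ofReal.comp (hWm.mono hle le_rfl))).symm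

lemma lintegral_indicator_newEdges [IsProbabilityMeasure μ]
    (hG : IsGenBarabasiAlbert μ G₀ M Y T G) (n m : ℕ) (e : Fin m → ℕ × Fin N) {f : Ω → ℝ≥0∞}
    (hf : Measurable[graphHistory G n] f) :
    ∫⁻ ω, {ω | M (n + 1) ω = m ∧
        ∀ i : Fin m, Y (n + 1) i ω = (e i).1 ∧ T (n + 1) i ω = (e i).2}.indicator f ω ∂μ =
      ∫⁻ ω, μ {ω | M (n + 1) ω = m} *
        ENNReal.ofReal (∏ i, (G n ω).attachProb (e i).1 (e i).2) * f ω ∂μ := by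
  have hle := hG.graphHistory_le n
  have hD := hG.measurableSet_newEdges n m e
  set D := {ω | M (n + 1) ω = m ∧
        ∀ i : Fin m, Y (n + 1) i ω = (e i).1 ∧ T (n + 1) i ω = (e i).2}
  set c : Ω → ℝ≥0∞ := fun ω => μ {ω | M (n + 1) ω = m} *
        ENNReal.ofReal (∏ i, (G n ω).attachProb (e i).1 (e i).2)
  have hc : Measurable c := hG.measurable_comp_graph' (fun g => μ {ω | M (n + 1) ω = m} *
        ENNReal.ofReal (∏ i, g.attachProb (e i).1 (e i).2)) n
  -- On the σ-algebra of the past, restricting to the event `D` is the same as having density `c`,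
  -- so the identity for events passes to functions.
  have heq : (μ.restrict D).trim hle = (μ.withDensity c).trim hle := by
    refine @Measure.ext _ (graphHistory G n) _ _ fun A hA => ?_
    rw [trim_measurableSet_eq hle hA, trim_measurableSet_eq hle hA,
      Measure.restrict_apply (hle A hA), withDensity_apply _ (hle A hA),
      hG.measure_inter_newEdges n m e hA]
  have hf' := hf.mono hle le_rfl
  rw [lintegral_indicator hD, ← lintegral_trim hle hf, heq, lintegral_trim hle hf,
    lintegral_withDensity_eq_lintegral_mul _ hc hf']
  rfl

/-- Conditionally on the past, the law of the number of new edges is `μ.map (M (n + 1))` and, given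
this number, the number of new edges in `S` is binomial. -/
lemma setLIntegral_step [IsProbabilityMeasure μ] (hG : IsGenBarabasiAlbert μ G₀ M Y T G) (n : ℕ)
    (S : ℕ × Fin N → Prop) [DecidablePred S] {Φ : TypedMultigraph N → ℕ → ℕ → ℝ}
    (hΦ : ∀ g m j, 0 ≤ Φ g m j) {A : Set Ω} (hA : MeasurableSet[graphHistory G n] A) :
    ∫⁻ ω in A, ENNReal.ofReal (Φ (G n ω) (M (n + 1) ω) (hits M Y T n S ω)) ∂μ =
      ∫⁻ ω in A, ∫⁻ m, ENNReal.ofReal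
        (binomialMean ((G n ω).attachMass S) m (Φ (G n ω) m)) ∂(μ.map (M (n + 1))) ∂μ := by
  have hle := hG.graphHistory_le n
  have hA0 := hle A hA
  set s : Finset (ℕ × Fin N) := Finset.range (G₀.numVertices + n) ×ˢ Finset.univ with hs
  set F : (m : ℕ) → (Fin m → ℕ × Fin N) → Ω → ℝ≥0∞ := fun m e ω =>
    A.indicator (fun ω => ENNReal.ofReal
      (Φ (G n ω) m (Finset.univ.filter fun i => S (e i)).card)) ω with hF
  have hFm : ∀ m e, Measurable[graphHistory G n] (F m e) := fun m e =>
    Measurable.indicator (measurable_comp_graph (fun g => ENNReal.ofReal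
      (Φ g m (Finset.univ.filter fun i => S (e i)).card)) n) hA
  -- Decompose by the number of new edges and their full list; exactly one summand survives. The
  -- finite set `s` suffices since endpoints are old vertices.
  have hpoint : ∀ ω, A.indicator (fun ω => ENNReal.ofReal
      (Φ (G n ω) (M (n + 1) ω) (hits M Y T n S ω))) ω =
      ∑' m, ∑ e ∈ Fintype.piFinset (fun _ : Fin m => s),
        {ω | M (n + 1) ω = m ∧
          ∀ i : Fin m, Y (n + 1) i ω = (e i).1 ∧ T (n + 1) i ω = (e i).2}.indicator (F m e) ω := by
    intro ω
    rw [tsum_eq_single (M (n + 1) ω), Finset.sum_eq_single_of_mem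
      (fun i : Fin (M (n + 1) ω) => (Y (n + 1) i ω, T (n + 1) i ω))]
    · have hmem : ω ∈ {ω' | M (n + 1) ω' = M (n + 1) ω ∧ ∀ i : Fin (M (n + 1) ω),
          Y (n + 1) i ω' = Y (n + 1) i ω ∧ T (n + 1) i ω' = T (n + 1) i ω} :=
        ⟨rfl, fun i => ⟨rfl, rfl⟩⟩
      rw [Set.indicator_of_mem hmem]
      have hcard : (Finset.univ.filter fun i : Fin (M (n + 1) ω) =>
          S (Y (n + 1) i ω, T (n + 1) i ω)).card = hits M Y T n S ω := by
        rw [hits, Finset.card_filter, Finset.card_filter,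
          ← Fin.sum_univ_eq_sum_range (fun i => if S (Y (n + 1) i ω, T (n + 1) i ω) then 1 else 0)]
      by_cases h : ω ∈ A
      · simp only [hF, Set.indicator_of_mem h, hcard]
      · simp only [hF, Set.indicator_of_notMem h]
    · refine Fintype.mem_piFinset.2 fun i => Finset.mem_product.2 ⟨?_, Finset.mem_univ _⟩
      rw [Finset.mem_range, ← hG.numVertices_eq n ω]
      exact hG.endpoint_lt n ω i.2
    · intro e _ he
      refine Set.indicator_of_notMem (fun h => he ?_) _
      exact ((newEdges_eq_iff n _ e ω).1 h).2
    · intro m hm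
      refine Finset.sum_eq_zero fun e _ => Set.indicator_of_notMem (fun h => hm h.1.symm) _
  have hmeas : ∀ m e, Measurable ({ω | M (n + 1) ω = m ∧
      ∀ i : Fin m, Y (n + 1) i ω = (e i).1 ∧ T (n + 1) i ω = (e i).2}.indicator (F m e)) :=
    fun m e => ((hFm m e).mono hle le_rfl).indicator (hG.measurableSet_newEdges n m e)
  have hmeas' : ∀ m (e : Fin m → ℕ × Fin N), Measurable fun ω => μ {ω | M (n + 1) ω = m} *
        ENNReal.ofReal (∏ i, (G n ω).attachProb (e i).1 (e i).2) * F m e ω := fun m e =>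
    (hG.measurable_comp_graph' (fun g => μ {ω | M (n + 1) ω = m} *
        ENNReal.ofReal (∏ i, g.attachProb (e i).1 (e i).2)) n).mul ((hFm m e).mono hle le_rfl)
  rw [← lintegral_indicator hA0, lintegral_congr hpoint,
    lintegral_tsum fun m => (Finset.measurable_sum _ fun e _ => hmeas m e).aemeasurable]
  simp_rw [lintegral_finsetSum _ fun e _ => hmeas _ e,
    hG.lintegral_indicator_newEdges n _ _ (hFm _ _),
    ← lintegral_finsetSum _ fun e _ => hmeas' _ e]
  rw [← lintegral_tsum fun m => (Finset.measurable_sum _ fun e _ => hmeas' m e).aemeasurable,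
    ← lintegral_indicator hA0]
  refine lintegral_congr fun ω => ?_
  by_cases h : ω ∈ A
  swap
  · simp [hF, h]
  rw [Set.indicator_of_mem h, lintegral_countable']
  refine tsum_congr fun m => ?_
  have hw : ∑ e ∈ s, (G n ω).attachProb e.1 e.2 = 1 := by
    rw [hs, ← hG.numVertices_eq n ω]
    exact sum_attachProb_product _ (hG.numEdgesIn_univ_pos n ω)
  have hmass : (G n ω).attachMass S = ∑ e ∈ s.filter S, (G n ω).attachProb e.1 e.2 := by
    rw [hs, attachMass, hG.numVertices_eq]
  -- Regrouping the lists of edges by their number of hits in `S` turns the product law into a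
  -- binomial one.
  rw [hmass, ← sum_piFinset_prod_mul s _ hw,
    ENNReal.ofReal_sum_of_nonneg fun e _ =>
      mul_nonneg (prod_attachProb_mem_Icc _ e).1 (hΦ _ _ _), Finset.sum_mul,
    Measure.map_apply (hG.measurable_M n) (measurableSet_singleton m)]
  refine Finset.sum_congr rfl fun e _ => ?_
  rw [ENNReal.ofReal_mul (prod_attachProb_mem_Icc _ e).1]
  simp only [hF, Set.indicator_of_mem h]
  rw [mul_assoc, mul_comm]
  rfl

lemma integrable_of_mem_Icc {α : Type*} [MeasurableSpace α] {ν : Measure α} [IsFiniteMeasure ν]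
    {f : α → ℝ} (hf : Measurable f) {C : ℝ} (h : ∀ a, f a ∈ Set.Icc 0 C) : Integrable f ν :=
  Integrable.of_bound hf.aestronglyMeasurable C (Eventually.of_forall fun a => by
    rw [Real.norm_of_nonneg (h a).1]; exact (h a).2)

lemma condExp_step [IsProbabilityMeasure μ] (hG : IsGenBarabasiAlbert μ G₀ M Y T G) (n : ℕ)
    (S : ℕ × Fin N → Prop) [DecidablePred S] {Φ : TypedMultigraph N → ℕ → ℕ → ℝ} {C : ℝ}
    (hΦ : ∀ g m j, Φ g m j ∈ Set.Icc 0 C) :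
    μ[fun ω => Φ (G n ω) (M (n + 1) ω) (hits M Y T n S ω) | graphHistory G n] =ᵐ[μ]
      fun ω => ∫ m, binomialMean ((G n ω).attachMass S) m (Φ (G n ω) m)
        ∂(μ.map (M (n + 1))) := by
  have hle := hG.graphHistory_le n
  have : IsProbabilityMeasure (μ.map (M (n + 1))) :=
    Measure.isProbabilityMeasure_map (hG.measurable_M n).aemeasurable
  set ρ := μ.map (M (n + 1))
  have hb : ∀ g : TypedMultigraph N, ∀ m,
      binomialMean (g.attachMass S) m (Φ g m) ∈ Set.Icc 0 C := fun g m =>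
    ⟨binomialMean_nonneg (g.attachMass_mem_Icc S) m fun j => (hΦ g m j).1,
      binomialMean_le (g.attachMass_mem_Icc S) m fun j => (hΦ g m j).2⟩
  have hbi : ∀ g : TypedMultigraph N,
      Integrable (fun m => binomialMean (g.attachMass S) m (Φ g m)) ρ := fun g =>
    integrable_of_mem_Icc (measurable_of_countable _) (hb g)
  set Ψ : TypedMultigraph N → ℝ := fun g => ∫ m, binomialMean (g.attachMass S) m (Φ g m) ∂ρ
  have hΨ : ∀ g, Ψ g ∈ Set.Icc 0 C := fun g => by
    refine ⟨integral_nonneg fun m => (hb g m).1, ?_⟩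
    simpa using integral_mono (hbi g) (integrable_const C) fun m => (hb g m).2
  have hΨi : Integrable (fun ω => Ψ (G n ω)) μ :=
    integrable_of_mem_Icc (hG.measurable_comp_graph' Ψ n) fun ω => hΨ _
  have hXi : Integrable (fun ω => Φ (G n ω) (M (n + 1) ω) (hits M Y T n S ω)) μ :=
    integrable_of_mem_Icc (hG.measurable_comp_step n S Φ) fun ω => hΦ _ _ _
  refine (ae_eq_condExp_of_forall_setIntegral_eq hle hXi (fun A _ _ => hΨi.integrableOn) ?_
    (measurable_comp_graph Ψ n).stronglyMeasurable.aestronglyMeasurable).symm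
  intro A hA _
  rw [integral_eq_lintegral_of_nonneg_ae (Eventually.of_forall fun ω => (hΨ _).1)
      hΨi.restrict.aestronglyMeasurable,
    integral_eq_lintegral_of_nonneg_ae (Eventually.of_forall fun ω => (hΦ _ _ _).1)
      hXi.restrict.aestronglyMeasurable,
    hG.setLIntegral_step n S (fun g m j => (hΦ g m j).1) hA]
  congr 1
  refine lintegral_congr fun ω => ?_
  exact ofReal_integral_eq_lintegral_ofReal (hbi _) (Eventually.of_forall fun m => (hb _ m).1)

end IsGenBarabasiAlbert

/-! ### A strong law for martingale differences. -/

/-- Kronecker's lemma for the weights `1 / (i + 1)`. -/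
lemma tendsto_sum_div_of_tendsto_sum {δ : ℕ → ℝ} {w : ℝ}
    (h : Tendsto (fun n => ∑ i ∈ Finset.range n, ((i : ℝ) + 1)⁻¹ * δ i) atTop (𝓝 w)) :
    Tendsto (fun n : ℕ => (∑ i ∈ Finset.range n, δ i) / (n : ℝ)) atTop (𝓝 0) := by
  set W : ℕ → ℝ := fun n => ∑ i ∈ Finset.range n, ((i : ℝ) + 1)⁻¹ * δ i with hW
  -- Summation by parts: after division by `n`, this is a convergent sequence minus its Cesàro
  -- means.
  have hsum : ∀ n : ℕ, ∑ i ∈ Finset.range n, δ i = n * W n - ∑ i ∈ Finset.range n, W i := by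
    intro n
    induction n with
    | zero => simp
    | succ n ih =>
      have h1 : W (n + 1) = W n + ((n : ℝ) + 1)⁻¹ * δ n := Finset.sum_range_succ _ _
      have h2 : (n : ℝ) + 1 ≠ 0 := by positivity
      rw [Finset.sum_range_succ, Finset.sum_range_succ, ih, h1]
      push_cast
      field_simp
      ring
  have h3 := h.sub h.cesaro
  rw [sub_self] at h3
  refine h3.congr' ?_
  filter_upwards [eventually_gt_atTop 0] with n hn
  have hn' : (n : ℝ) ≠ 0 := by positivity
  rw [hsum]
  field_simp

lemma integral_sub_condExp_sq_le {Ω : Type*} {m mΩ : MeasurableSpace Ω} {μ : Measure Ω}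
    [IsProbabilityMeasure μ] (hm : m ≤ mΩ) {ξ : Ω → ℝ} (hξ : MemLp ξ 2 μ) :
    ∫ ω, (ξ ω - (μ[ξ | m]) ω) ^ 2 ∂μ ≤ ∫ ω, ξ ω ^ 2 ∂μ := by
  have h := integral_mono_ae integrable_condVar integrable_condExp
    (condVar_ae_le_condExp_sq hm hξ)
  rw [integral_condExp hm, condVar, integral_condExp hm] at h
  exact h

/-- A strong law of large numbers for martingale differences that are bounded in `L²`. -/
lemma ae_tendsto_sum_sub_condExp_div {Ω : Type*} {mΩ : MeasurableSpace Ω} {μ : Measure Ω}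
    [IsProbabilityMeasure μ] (ℱ : Filtration ℕ mΩ) {ξ : ℕ → Ω → ℝ}
    (hadp : ∀ n, StronglyMeasurable[ℱ (n + 1)] (ξ n)) (hL2 : ∀ n, MemLp (ξ n) 2 μ) {C : ℝ}
    (hC : ∀ n, ∫ ω, ξ n ω ^ 2 ∂μ ≤ C) :
    ∀ᵐ ω ∂μ, Tendsto (fun n : ℕ =>
      (∑ i ∈ Finset.range n, (ξ i ω - (μ[ξ i | ℱ i]) ω)) / (n : ℝ)) atTop (𝓝 0) := by
  set Δ : ℕ → Ω → ℝ := fun n => ξ n - μ[ξ n | ℱ n] with hΔ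
  have hΔ2 : ∀ n, MemLp (Δ n) 2 μ := fun n => (hL2 n).sub ((hL2 n).condExp one_le_two)
  have hΔm : ∀ n, StronglyMeasurable[ℱ (n + 1)] (Δ n) := fun n =>
    (hadp n).sub (stronglyMeasurable_condExp.mono (ℱ.mono n.le_succ))
  have hξi : ∀ n, Integrable (ξ n) μ := fun n => (hL2 n).integrable one_le_two
  have hΔi : ∀ n, Integrable (Δ n) μ := fun n => (hΔ2 n).integrable one_le_two
  have hΔ0 : ∀ n, μ[Δ n | ℱ n] =ᵐ[μ] 0 := by
    intro n
    have h1 := condExp_sub (hξi n) (integrable_condExp (m := ℱ n) (f := ξ n)) (ℱ n)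
    rw [condExp_of_stronglyMeasurable (ℱ.le n) stronglyMeasurable_condExp integrable_condExp,
      sub_self] at h1
    exact h1
  set W : ℕ → Ω → ℝ := fun n => ∑ i ∈ Finset.range n, ((i : ℝ) + 1)⁻¹ • Δ i with hW
  have hW1 : ∀ n, W (n + 1) = W n + ((n : ℝ) + 1)⁻¹ • Δ n := fun n => Finset.sum_range_succ _ _
  have hWm : ∀ n, StronglyMeasurable[ℱ n] (W n) := fun n =>
    Finset.stronglyMeasurable_sum _ fun i hi =>
      ((hΔm i).mono (ℱ.mono (Finset.mem_range.1 hi))).const_smul _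
  have hW2 : ∀ n, MemLp (W n) 2 μ := fun n => memLp_finsetSum' _ fun i _ => (hΔ2 i).const_smul _
  have hWi : ∀ n, Integrable (W n) μ := fun n => (hW2 n).integrable one_le_two
  have hmart : Martingale W ℱ μ := by
    refine martingale_of_condExp_sub_eq_zero_nat hWm hWi fun n => ?_
    rw [hW1, add_sub_cancel_left]
    filter_upwards [condExp_smul ((n : ℝ) + 1)⁻¹ (Δ n) (ℱ n) (μ := μ), hΔ0 n] with ω h1 h2
    rw [h1, Pi.smul_apply, h2]
    simp
  -- Orthogonality of increments: it removes the cross term when `W (n + 1) ^ 2` is expanded.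
  have horth : ∀ n, ∫ ω, W n ω * Δ n ω ∂μ = 0 := by
    intro n
    have hint : Integrable (W n * Δ n) μ := (hW2 n).integrable_mul (hΔ2 n)
    have h1 := condExp_mul_of_stronglyMeasurable_left (hWm n) hint (hΔi n)
    rw [← Pi.mul_def, ← integral_condExp (ℱ.le n), integral_congr_ae h1,
      integral_congr_ae (g := 0) ?_]
    · simp
    · filter_upwards [hΔ0 n] with ω h
      simp [h]
  have hsumm : Summable fun i : ℕ => (((i : ℝ) + 1)⁻¹) ^ 2 := by
    have := (summable_nat_add_iff 1).2 (Real.summable_one_div_nat_pow.2 one_lt_two)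
    simpa using this
  have hC0 : 0 ≤ C := (integral_nonneg fun ω => sq_nonneg _).trans (hC 0)
  have hbd : ∀ n, ∫ ω, W n ω ^ 2 ∂μ ≤ C * ∑ i ∈ Finset.range n, (((i : ℝ) + 1)⁻¹) ^ 2 := by
    intro n
    induction n with
    | zero => simp [hW]
    | succ n ih =>
      have h1 : ∀ ω, W (n + 1) ω ^ 2 = W n ω ^ 2 + 2 * ((n : ℝ) + 1)⁻¹ * (W n ω * Δ n ω) +
          (((n : ℝ) + 1)⁻¹) ^ 2 * Δ n ω ^ 2 := fun ω => by
        rw [hW1, Pi.add_apply, Pi.smul_apply, smul_eq_mul]; ring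
      have hi1 : Integrable (fun ω => W n ω ^ 2) μ := (hW2 n).integrable_sq
      have hi2 : Integrable (fun ω => 2 * ((n : ℝ) + 1)⁻¹ * (W n ω * Δ n ω)) μ :=
        ((hW2 n).integrable_mul (hΔ2 n)).const_mul _
      have hi3 : Integrable (fun ω => (((n : ℝ) + 1)⁻¹) ^ 2 * Δ n ω ^ 2) μ :=
        (hΔ2 n).integrable_sq.const_mul _
      have hi12 : Integrable (fun ω => W n ω ^ 2 + 2 * ((n : ℝ) + 1)⁻¹ * (W n ω * Δ n ω)) μ :=
        hi1.add hi2
      simp only [h1]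
      rw [integral_add hi12 hi3, integral_add hi1 hi2, integral_const_mul,
        integral_const_mul, horth, Finset.sum_range_succ, mul_add]
      have h2 := (integral_sub_condExp_sq_le (ℱ.le n) (hL2 n)).trans (hC n)
      have h3 := mul_le_mul_of_nonneg_left h2 (sq_nonneg (((n : ℝ) + 1)⁻¹))
      simp only [hΔ, Pi.sub_apply]
      linarith
  set R : ℝ := 1 + C * ∑' i : ℕ, (((i : ℝ) + 1)⁻¹) ^ 2 with hR
  have hL1 : ∀ n, eLpNorm (W n) 1 μ ≤ (R.toNNReal : ℝ≥0∞) := by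
    intro n
    have hi1 : Integrable (fun ω => W n ω ^ 2) μ := (hW2 n).integrable_sq
    rw [eLpNorm_one_eq_lintegral_enorm, ← ofReal_integral_norm_eq_lintegral_enorm (hWi n)]
    refine ENNReal.ofReal_le_ofReal ?_
    calc ∫ ω, ‖W n ω‖ ∂μ ≤ ∫ ω, (1 + W n ω ^ 2) ∂μ := by
          refine integral_mono (hWi n).norm ((integrable_const _).add hi1) fun ω => ?_
          simp only [Real.norm_eq_abs]
          nlinarith [sq_abs (W n ω), sq_nonneg (|W n ω| - 1), abs_nonneg (W n ω)]
      _ = 1 + ∫ ω, W n ω ^ 2 ∂μ := by rw [integral_add (integrable_const _) hi1]; simp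
      _ ≤ R := by
          rw [hR]
          gcongr
          exact (hbd n).trans (mul_le_mul_of_nonneg_left
            (hsumm.sum_le_tsum _ fun i _ => sq_nonneg _) hC0)
  filter_upwards [hmart.submartingale.ae_tendsto_limitProcess hL1] with ω hω
  refine tendsto_sum_div_of_tendsto_sum (w := Filtration.limitProcess W ℱ μ ω) (hω.congr fun n => ?_)
  simp [hW, hΔ]

/-! ### Mixed binomial laws. -/

/-- The probability of `l` under the mixture of the binomial distributions with parameters `m` and
`p`, where `m` has law `ρ`. -/
noncomputable def mixedBinomial (ρ : Measure ℕ) (p : ℝ) (l : ℕ) : ℝ :=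
  ∫ m, binomialMean p m (fun j => if j = l then 1 else 0) ∂ρ

section MixedBinomial

variable {ρ : Measure ℕ} {p : ℝ}

lemma binomialMean_ite_mem_Icc (hp : p ∈ Set.Icc (0 : ℝ) 1) (m : ℕ) (P : ℕ → Prop)
    [DecidablePred P] : binomialMean p m (fun j => if P j then 1 else 0) ∈ Set.Icc (0 : ℝ) 1 :=
  ⟨binomialMean_nonneg hp m fun j => by split_ifs <;> simp,
    binomialMean_le hp m fun j => by split_ifs <;> simp⟩

lemma integrable_binomialMean_ite [IsProbabilityMeasure ρ] (hp : p ∈ Set.Icc (0 : ℝ) 1)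
    (P : ℕ → Prop) [DecidablePred P] :
    Integrable (fun m => binomialMean p m (fun j => if P j then 1 else 0)) ρ :=
  IsGenBarabasiAlbert.integrable_of_mem_Icc (measurable_of_countable _)
    fun m => binomialMean_ite_mem_Icc hp m P

lemma mixedBinomial_nonneg (hp : p ∈ Set.Icc (0 : ℝ) 1) (l : ℕ) : 0 ≤ mixedBinomial ρ p l :=
  integral_nonneg fun m => (binomialMean_ite_mem_Icc hp m fun j => j = l).1

lemma tendsto_mixedBinomial [IsProbabilityMeasure ρ] {u : ℕ → ℝ}
    (hu : ∀ n, u n ∈ Set.Icc (0 : ℝ) 1) (h : Tendsto u atTop (𝓝 p)) (l : ℕ) :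
    Tendsto (fun n => mixedBinomial ρ (u n) l) atTop (𝓝 (mixedBinomial ρ p l)) := by
  refine tendsto_integral_of_dominated_convergence (fun _ => 1)
    (fun n => (measurable_of_countable _).aestronglyMeasurable) (integrable_const _)
    (fun n => Eventually.of_forall fun m => ?_) (Eventually.of_forall fun m => ?_)
  · have h := binomialMean_ite_mem_Icc (hu n) m fun j => j = l
    rw [Real.norm_of_nonneg h.1]
    exact h.2
  · exact ((continuous_binomialMean m _).tendsto p).comp h

lemma measurable_mixedBinomial [SFinite ρ] (l : ℕ) :
    Measurable fun p => mixedBinomial ρ p l := by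
  have h : Measurable (Function.uncurry fun (p : ℝ) (m : ℕ) =>
      binomialMean p m (fun j => if j = l then 1 else 0)) :=
    measurable_from_prod_countable_left fun m => (continuous_binomialMean m _).measurable
  exact h.stronglyMeasurable.integral_prod_right.measurable

lemma measurable_degreeLimit [SFinite ρ] (l : ℕ) :
    Measurable fun p => degreeLimit (mixedBinomial ρ p) l := by
  induction l with
  | zero => exact measurable_mixedBinomial 0
  | succ l ih =>
    exact (((measurable_mixedBinomial (l + 1)).const_mul 2).add (ih.const_mul (l : ℝ))).div_const _

lemma hasSum_mul_mixedBinomial [IsProbabilityMeasure ρ] (hp : p ∈ Set.Icc (0 : ℝ) 1)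
    {f : ℕ → ℝ} (hf : ∀ l, 0 ≤ f l) (hint : Integrable (fun m => binomialMean p m f) ρ) :
    HasSum (fun l => f l * mixedBinomial ρ p l) (∫ m, binomialMean p m f ∂ρ) := by
  have hsum : ∀ m, HasSum (fun l => f l * binomialMean p m (fun j => if j = l then 1 else 0))
      (binomialMean p m f) := by
    intro m
    rw [binomialMean_eq_sum m f le_rfl]
    refine hasSum_sum_of_ne_finset_zero fun l hl => ?_
    rw [binomialMean_congr (g := fun _ => 0), binomialMean_const, mul_zero]
    intro j hj
    rw [if_neg]
    simp only [Finset.mem_range] at hl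
    omega
  simp only [mixedBinomial, ← integral_const_mul]
  refine hasSum_integral_of_dominated_convergence
    (fun l m => f l * binomialMean p m (fun j => if j = l then 1 else 0))
    (fun l => (measurable_of_countable _).aestronglyMeasurable)
    (fun l => Eventually.of_forall fun m => ?_)
    (Eventually.of_forall fun m => (hsum m).summable) ?_ (Eventually.of_forall hsum)
  · rw [Real.norm_of_nonneg (mul_nonneg (hf l) (binomialMean_ite_mem_Icc hp m fun j => j = l).1)]
  · exact hint.congr (Eventually.of_forall fun m => (hsum m).tsum_eq.symm)

lemma hasSum_mixedBinomial [IsProbabilityMeasure ρ] (hp : p ∈ Set.Icc (0 : ℝ) 1) :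
    HasSum (mixedBinomial ρ p) 1 := by
  have h := hasSum_mul_mixedBinomial (ρ := ρ) hp (f := fun _ => 1) (fun _ => zero_le_one)
    (by simp only [binomialMean_const]; exact integrable_const 1)
  simpa [binomialMean_const] using h

lemma integrable_cast (h2 : Integrable (fun m : ℕ => (m : ℝ) ^ 2) ρ) :
    Integrable (fun m : ℕ => (m : ℝ)) ρ := by
  refine h2.mono (measurable_of_countable _).aestronglyMeasurable (Eventually.of_forall fun m => ?_)
  rw [Real.norm_of_nonneg (Nat.cast_nonneg m), Real.norm_of_nonneg (sq_nonneg _)]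
  exact_mod_cast Nat.le_self_pow two_ne_zero m

lemma integrable_cast_mul_pred (h2 : Integrable (fun m : ℕ => (m : ℝ) ^ 2) ρ) :
    Integrable (fun m : ℕ => (m : ℝ) * (m - 1)) ρ :=
  (h2.sub (integrable_cast h2)).congr (Eventually.of_forall fun m => by
    simp only [Pi.sub_apply]; ring)

lemma cast_mul_pred_nonneg (m : ℕ) : (0 : ℝ) ≤ (m : ℝ) * (m - 1) := by
  rcases Nat.eq_zero_or_pos m with h | h
  · simp [h]
  · have : (1 : ℝ) ≤ m := by exact_mod_cast h
    exact mul_nonneg (by linarith) (by linarith)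

/-- This sum is half of the tail constant, by `tendsto_degreeLimit_mul_cube`. -/
lemma hasSum_mul_succ_mixedBinomial [IsProbabilityMeasure ρ] (hp : p ∈ Set.Icc (0 : ℝ) 1)
    (h2 : Integrable (fun m : ℕ => (m : ℝ) ^ 2) ρ) :
    HasSum (fun l : ℕ => (l : ℝ) * (l + 1) * mixedBinomial ρ p l)
      ((∫ m, (m : ℝ) * (m - 1) ∂ρ) * p ^ 2 + 2 * ((∫ m, (m : ℝ) ∂ρ) * p)) := by
  have hi1 := (integrable_cast_mul_pred h2).mul_const (p ^ 2)
  have hi2 := ((integrable_cast h2).mul_const p).const_mul 2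
  have h := hasSum_mul_mixedBinomial (ρ := ρ) hp (f := fun l : ℕ => (l : ℝ) * (l + 1))
    (fun l => by positivity)
    (by simp only [binomialMean_mul_succ]; exact hi1.add hi2)
  simp only [binomialMean_mul_succ] at h
  rwa [integral_add hi1 hi2, integral_mul_const, integral_const_mul, integral_mul_const] at h

/-- One step changes a degree `d` by a binomial number whose mean is small: up to a second-order
error, the degree moves from `d` to `d + 1` with probability equal to this mean. -/
lemma abs_integral_binomialMean_sub_le [IsProbabilityMeasure ρ]
    (hp : p ∈ Set.Icc (0 : ℝ) 1) (h2 : Integrable (fun m : ℕ => (m : ℝ) ^ 2) ρ) (d l : ℕ) :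
    |∫ m, binomialMean p m (fun j => if d + j = l then 1 else 0) ∂ρ -
        (if d = l then 1 else 0) -
        (∫ m, (m : ℝ) ∂ρ) * p * ((if d + 1 = l then 1 else 0) - (if d = l then 1 else 0))| ≤
      if d ≤ l then (∫ m, (m : ℝ) * (m - 1) ∂ρ) * p ^ 2 else 0 := by
  set s : ℝ := (if d + 1 = l then 1 else 0) - (if d = l then 1 else 0) with hs
  have hi1 := integrable_binomialMean_ite (ρ := ρ) hp fun j => d + j = l
  have hi2 : Integrable (fun _ : ℕ => if d = l then (1 : ℝ) else 0) ρ := integrable_const _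
  have hi3 : Integrable (fun m : ℕ => (m : ℝ) * p * s) ρ :=
    ((integrable_cast h2).mul_const p).mul_const s
  have hi12 : Integrable (fun m => binomialMean p m (fun j => if d + j = l then 1 else 0) -
      if d = l then (1 : ℝ) else 0) ρ := hi1.sub hi2
  have heq : ∫ m, binomialMean p m (fun j => if d + j = l then 1 else 0) ∂ρ -
        (if d = l then 1 else 0) - (∫ m, (m : ℝ) ∂ρ) * p * s =
      ∫ m, binomialMean p m (fun j => (if d + j = l then 1 else 0) - (if d = l then 1 else 0) -
        (j : ℝ) * s) ∂ρ := by
    have h : ∀ m : ℕ, binomialMean p m (fun j => (if d + j = l then 1 else 0) -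
        (if d = l then 1 else 0) - (j : ℝ) * s) =
        binomialMean p m (fun j => if d + j = l then 1 else 0) -
          (if d = l then (1 : ℝ) else 0) - (m : ℝ) * p * s := by
      intro m
      have h1 : (fun j : ℕ => (j : ℝ) * s) = fun j : ℕ => s * (j : ℝ) := by
        funext j; ring
      rw [binomialMean_sub, binomialMean_sub, binomialMean_const, h1, binomialMean_const_mul,
        binomialMean_id]
      ring
    simp only [h]
    rw [integral_sub hi12 hi3, integral_sub hi1 hi2, integral_mul_const, integral_mul_const]
    simp
  have hbound : ∀ m : ℕ, ‖binomialMean p m (fun j => (if d + j = l then 1 else 0) -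
      (if d = l then 1 else 0) - (j : ℝ) * s)‖ ≤
      if d ≤ l then (m : ℝ) * (m - 1) * p ^ 2 else 0 := by
    intro m
    refine (abs_binomialMean_le hp m _).trans ?_
    -- The expression is the error of linear interpolation between `j = 0` and `j = 1`: it vanishes
    -- at both, so `j * (j - 1)` can dominate it. For `l < d` all indicators vanish.
    have h : ∀ j : ℕ, |(if d + j = l then 1 else 0) - (if d = l then 1 else 0) - (j : ℝ) * s| ≤
        (if d ≤ l then 1 else 0) * ((j : ℝ) * (j - 1)) := by
      intro j
      rcases lt_or_ge l d with hdl | hdl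
      · rw [hs, if_neg (by omega), if_neg (by omega), if_neg (by omega), if_neg (by omega)]
        simp
      rw [if_pos hdl, one_mul]
      obtain rfl | rfl | hj : j = 0 ∨ j = 1 ∨ 2 ≤ j := by omega
      · simp
      · simp [hs]
      have hj' : (2 : ℝ) ≤ j := by exact_mod_cast hj
      rw [hs, abs_le]
      split_ifs <;> first | omega | (constructor <;> nlinarith)
    refine (binomialMean_mono hp m h).trans ?_
    rw [binomialMean_const_mul, binomialMean_mul_pred]
    split_ifs <;> simp
  rw [heq, ← Real.norm_eq_abs]
  refine (norm_integral_le_of_norm_le ?_ (Eventually.of_forall hbound)).trans ?_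
  · split_ifs
    · exact (integrable_cast_mul_pred h2).mul_const _
    · exact integrable_zero _ _ _
  · split_ifs
    · rw [integral_mul_const]
    · simp

end MixedBinomial

/-! ### Growth of the edge number and the limiting proportion of types. -/

namespace IsGenBarabasiAlbert

open TypedMultigraph

variable {Ω : Type*} [MeasurableSpace Ω] {μ : Measure Ω} {N : ℕ}
  {G₀ : TypedMultigraph N} {M : ℕ → Ω → ℕ} {Y : ℕ → ℕ → Ω → ℕ} {T : ℕ → ℕ → Ω → Fin N}
  {G : ℕ → Ω → TypedMultigraph N} {ρ : Measure ℕ}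

lemma integral_step_law (hG : IsGenBarabasiAlbert μ G₀ M Y T G)
    (hρ : ∀ n, μ.map (M (n + 1)) = ρ) (n : ℕ) (f : ℕ → ℝ) :
    ∫ ω, f (M (n + 1) ω) ∂μ = ∫ m, f m ∂ρ := by
  rw [← hρ n, integral_map (hG.measurable_M n).aemeasurable
    (measurable_of_countable f).aestronglyMeasurable]

lemma integrable_step_law (hG : IsGenBarabasiAlbert μ G₀ M Y T G)
    (hρ : ∀ n, μ.map (M (n + 1)) = ρ) (n : ℕ) {f : ℕ → ℝ} (hf : Integrable f ρ) :
    Integrable (fun ω => f (M (n + 1) ω)) μ := by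
  rw [← hρ n] at hf
  exact hf.comp_measurable (hG.measurable_M n)

lemma isProbabilityMeasure_law [IsProbabilityMeasure μ]
    (hG : IsGenBarabasiAlbert μ G₀ M Y T G)
    (hρ : ∀ n, μ.map (M (n + 1)) = ρ) : IsProbabilityMeasure ρ :=
  hρ 0 ▸ Measure.isProbabilityMeasure_map (hG.measurable_M 0).aemeasurable

lemma one_le_integral_law [IsProbabilityMeasure μ]
    (hG : IsGenBarabasiAlbert μ G₀ M Y T G)
    (hρ : ∀ n, μ.map (M (n + 1)) = ρ) (h2 : Integrable (fun m : ℕ => (m : ℝ) ^ 2) ρ) :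
    1 ≤ ∫ m, (m : ℝ) ∂ρ := by
  rw [← hG.integral_step_law hρ 0 fun m => (m : ℝ)]
  have h := integral_mono (integrable_const (1 : ℝ))
    (hG.integrable_step_law hρ 0 (integrable_cast h2)) (fun ω => Nat.one_le_cast.2 (hG.M_pos 0 ω))
  simpa using h

/-- The number of edges grows linearly. -/
lemma ae_tendsto_numEdgesIn_div [IsProbabilityMeasure μ]
    (hG : IsGenBarabasiAlbert μ G₀ M Y T G)
    (hρ : ∀ n, μ.map (M (n + 1)) = ρ) (h2 : Integrable (fun m : ℕ => (m : ℝ) ^ 2) ρ) :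
    ∀ᵐ ω ∂μ, Tendsto (fun n : ℕ => ((G n ω).numEdgesIn Finset.univ : ℝ) / n) atTop
      (𝓝 (∫ m, (m : ℝ) ∂ρ)) := by
  -- `M (n + 1)` is the increment of the edge number, so the graphs determine it.
  have hξm : ∀ n, Measurable[graphHistory G (n + 1)] fun ω => (M (n + 1) ω : ℝ) := by
    intro n
    have h1 : Measurable[graphHistory G (n + 1)] fun ω =>
        ((G n ω).numEdgesIn Finset.univ : ℝ) :=
      (measurable_comp_graph (fun g => (g.numEdgesIn Finset.univ : ℝ)) n).mono
        (hG.filtration.mono n.le_succ) le_rfl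
    have h3 : Measurable[graphHistory G (n + 1)] fun ω =>
        ((G (n + 1) ω).numEdgesIn Finset.univ : ℝ) :=
      measurable_comp_graph (fun g => (g.numEdgesIn Finset.univ : ℝ)) (n + 1)
    have h4 : (fun ω => (M (n + 1) ω : ℝ)) = fun ω =>
        ((G (n + 1) ω).numEdgesIn Finset.univ : ℝ) - ((G n ω).numEdgesIn Finset.univ : ℝ) := by
      funext ω
      rw [hG.numEdgesIn_univ_succ]
      push_cast
      ring
    rw [h4]
    exact h3.sub h1
  have hcond : ∀ n, μ[fun ω => (M (n + 1) ω : ℝ) | graphHistory G n] =ᵐ[μ]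
      fun _ => ∫ m, (m : ℝ) ∂ρ := by
    intro n
    rw [← hG.integral_step_law hρ n fun m => (m : ℝ)]
    refine condExp_indep_eq (hG.measurable_M n).comap_le (hG.graphHistory_le n) ?_ (hG.indep_M n)
    exact Measurable.stronglyMeasurable
      ((measurable_of_countable fun m : ℕ => (m : ℝ)).comp (comap_measurable _))
  have hslln := ae_tendsto_sum_sub_condExp_div hG.filtration
    (ξ := fun n ω => (M (n + 1) ω : ℝ)) (C := ∫ m, (m : ℝ) ^ 2 ∂ρ)
    (fun n => (hξm n).stronglyMeasurable)
    (fun n => (memLp_two_iff_integrable_sq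
      ((hξm n).mono (hG.graphHistory_le _) le_rfl).aestronglyMeasurable).2
        (hG.integrable_step_law hρ n h2))
    (fun n => (hG.integral_step_law hρ n fun m => (m : ℝ) ^ 2).le)
  filter_upwards [hslln, ae_all_iff.2 hcond] with ω h hc
  have hsum : ∀ n : ℕ, ((G n ω).numEdgesIn Finset.univ : ℝ) =
      G₀.numEdgesIn Finset.univ + ∑ i ∈ Finset.range n, (M (i + 1) ω : ℝ) := by
    intro n
    induction n with
    | zero => simp [hG.init]
    | succ n ih =>
      rw [hG.numEdgesIn_univ_succ, Finset.sum_range_succ, Nat.cast_add, ih, add_assoc]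
  have h0 := ((tendsto_inv_atTop_nhds_zero_nat (𝕜 := ℝ)).const_mul
    (G₀.numEdgesIn Finset.univ : ℝ)).add (h.add_const (∫ m, (m : ℝ) ∂ρ))
  simp only [mul_zero, zero_add] at h0
  refine h0.congr' ?_
  filter_upwards [eventually_gt_atTop 0] with n hn
  have hn' : (n : ℝ) ≠ 0 := by positivity
  have h3 : ∑ i ∈ Finset.range n, ((M (i + 1) ω : ℝ) -
      (μ[fun ω => (M (i + 1) ω : ℝ) | hG.filtration i]) ω) =
      ∑ i ∈ Finset.range n, (M (i + 1) ω : ℝ) - n * ∫ m, (m : ℝ) ∂ρ := by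
    have h4 : ∀ i ∈ Finset.range n, (μ[fun ω => (M (i + 1) ω : ℝ) | hG.filtration i]) ω =
        ∫ m, (m : ℝ) ∂ρ := fun i _ => hc i
    rw [Finset.sum_sub_distrib, Finset.sum_congr rfl h4]
    simp
  rw [h3, hsum]
  field_simp
  ring

/-- The minimum changes nothing here, but it keeps the quotient in `[0, 1]` for all arguments, as
`condExp_step` demands. -/
lemma proportion_succ (hG : IsGenBarabasiAlbert μ G₀ M Y T G) (K : Finset (Fin N)) (n : ℕ)
    (ω : Ω) :
    (G (n + 1) ω).proportion K =
      (((G n ω).numEdgesIn K : ℝ) +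
        (min (hits M Y T n (fun e => e.2 ∈ K) ω) (M (n + 1) ω) : ℕ)) /
      ((G n ω).numEdgesIn Finset.univ + (M (n + 1) ω : ℝ)) := by
  rw [proportion, hG.numEdgesIn_succ, hG.numEdgesIn_univ_succ, min_eq_left (hits_le M Y T n _ ω)]
  push_cast
  rfl

/-- Pólya urn: with `a` of `A` edges in `K`, the new count is on average `a + m * (a / A)`, which is
the fraction `a / A` of `A + m`, for each batch size `m`. -/
lemma condExp_proportion [IsProbabilityMeasure μ]
    (hG : IsGenBarabasiAlbert μ G₀ M Y T G) (K : Finset (Fin N)) (n : ℕ) :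
    μ[fun ω => (G (n + 1) ω).proportion K | graphHistory G n] =ᵐ[μ]
      fun ω => (G n ω).proportion K := by
  have : IsProbabilityMeasure (μ.map (M (n + 1))) :=
    Measure.isProbabilityMeasure_map (hG.measurable_M n).aemeasurable
  have h := hG.condExp_step n (fun e => e.2 ∈ K) (C := 1)
    (Φ := fun g m j => ((g.numEdgesIn K : ℝ) + (min j m : ℕ)) /
      (g.numEdgesIn Finset.univ + (m : ℝ))) (fun g m j => ⟨by positivity, by
        refine div_le_one_of_le₀ ?_ (by positivity)
        exact_mod_cast add_le_add (g.numEdgesIn_le K) (min_le_right j m)⟩)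
  simp only [← hG.proportion_succ] at h
  refine h.trans (Eventually.of_forall fun ω => ?_)
  have hpos : (0 : ℝ) < (G n ω).numEdgesIn Finset.univ := by
    exact_mod_cast hG.numEdgesIn_univ_pos n ω
  have hconst : ∀ m, binomialMean ((G n ω).attachMass fun e => e.2 ∈ K) m
      (fun j => (((G n ω).numEdgesIn K : ℝ) + (min j m : ℕ)) /
        ((G n ω).numEdgesIn Finset.univ + (m : ℝ))) = (G n ω).proportion K := by
    intro m
    rw [attachMass_snd_mem, binomialMean_congr (g := fun j =>
      ((G n ω).numEdgesIn Finset.univ + (m : ℝ))⁻¹ * (((G n ω).numEdgesIn K : ℝ) + (j : ℝ)))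
      (fun j hj => by rw [min_eq_left hj, div_eq_inv_mul]), binomialMean_const_mul,
      binomialMean_add, binomialMean_const, binomialMean_id]
    rw [proportion]
    field_simp
  simp only [hconst]
  simp

lemma exists_tendsto_proportion [IsProbabilityMeasure μ]
    (hG : IsGenBarabasiAlbert μ G₀ M Y T G) (K : Finset (Fin N)) :
    ∃ p : Ω → ℝ, Measurable p ∧
      ∀ᵐ ω ∂μ, Tendsto (fun n => (G n ω).proportion K) atTop (𝓝 (p ω)) := by
  have hint : ∀ n, Integrable (fun ω => (G n ω).proportion K) μ := fun n =>
    integrable_of_mem_Icc (hG.measurable_comp_graph' (fun g => g.proportion K) n)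
      fun ω => (G n ω).proportion_mem_Icc K
  have hmart : Martingale (fun n ω => (G n ω).proportion K) hG.filtration μ :=
    martingale_nat
      (fun n => (measurable_comp_graph (fun g => g.proportion K) n).stronglyMeasurable) hint
      fun n => (hG.condExp_proportion K n).symm
  refine ⟨_, (Filtration.stronglyMeasurable_limit_process' (ℱ := hG.filtration) (μ := μ)
    (f := fun n ω => (G n ω).proportion K)).measurable,
    hmart.submartingale.ae_tendsto_limitProcess (R := 1) fun n => ?_⟩
  refine (eLpNorm_le_of_ae_bound (C := 1) (Eventually.of_forall fun ω => ?_)).trans (by simp)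
  rw [Real.norm_of_nonneg ((G n ω).proportion_mem_Icc K).1]
  exact ((G n ω).proportion_mem_Icc K).2

lemma lintegral_halfProd_succ_le [IsProbabilityMeasure μ]
    (hG : IsGenBarabasiAlbert μ G₀ M Y T G) {K : Finset (Fin N)}
    (hK : K.Nonempty) (n : ℕ) :
    ∫⁻ ω, ENNReal.ofReal (halfProd ((G (n + 1) ω).numEdgesIn K) /
        halfProd ((G (n + 1) ω).numEdgesIn Finset.univ)) ∂μ ≤
      ∫⁻ ω, ENNReal.ofReal (halfProd ((G n ω).numEdgesIn K) /
        halfProd ((G n ω).numEdgesIn Finset.univ)) ∂μ := by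
  have : IsProbabilityMeasure (μ.map (M (n + 1))) :=
    Measure.isProbabilityMeasure_map (hG.measurable_M n).aemeasurable
  have h := hG.setLIntegral_step n (fun e => e.2 ∈ K)
    (Φ := fun g m j => halfProd (g.numEdgesIn K + j) / halfProd (g.numEdgesIn Finset.univ + m))
    (fun g m j => (div_pos (halfProd_pos _) (halfProd_pos _)).le) MeasurableSet.univ
  simp only [Measure.restrict_univ, ← hG.numEdgesIn_succ, ← hG.numEdgesIn_univ_succ] at h
  rw [h]
  refine lintegral_mono fun ω => ?_
  have hle : ∀ m, ENNReal.ofReal (binomialMean ((G n ω).attachMass fun e => e.2 ∈ K) m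
      fun j => halfProd ((G n ω).numEdgesIn K + j) /
        halfProd ((G n ω).numEdgesIn Finset.univ + m)) ≤
      ENNReal.ofReal (halfProd ((G n ω).numEdgesIn K) /
        halfProd ((G n ω).numEdgesIn Finset.univ)) := by
    intro m
    refine ENNReal.ofReal_le_ofReal ?_
    have h1 := binomialMean_halfProd_le (hG.numEdgesIn_pos hK n ω) ((G n ω).numEdgesIn_le K) m
    simp only [div_eq_inv_mul (halfProd (_ + _)), binomialMean_const_mul]
    rw [attachMass_snd_mem, inv_mul_le_iff₀ (halfProd_pos _), mul_comm]
    exact h1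
  refine (lintegral_mono hle).trans ?_
  simp

/-- If the proportion tended to `0`, then `H` would tend to infinity, but its expectations are
bounded and Fatou's lemma makes its lower limit finite almost surely. -/
lemma ae_limit_pos [IsProbabilityMeasure μ]
    (hG : IsGenBarabasiAlbert μ G₀ M Y T G) {K : Finset (Fin N)}
    (hK : K.Nonempty) {p : Ω → ℝ}
    (hp : ∀ᵐ ω ∂μ, Tendsto (fun n => (G n ω).proportion K) atTop (𝓝 (p ω))) :
    ∀ᵐ ω ∂μ, 0 < p ω := by
  set H : ℕ → Ω → ℝ := fun n ω => halfProd ((G n ω).numEdgesIn K) /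
        halfProd ((G n ω).numEdgesIn Finset.univ) with hH
  have hHm : ∀ n, Measurable fun ω => ENNReal.ofReal (H n ω) := fun n =>
    hG.measurable_comp_graph' (fun g => ENNReal.ofReal (halfProd (g.numEdgesIn K) /
        halfProd (g.numEdgesIn Finset.univ))) n
  have hbd : ∀ n, ∫⁻ ω, ENNReal.ofReal (H n ω) ∂μ ≤
      ENNReal.ofReal (halfProd (G₀.numEdgesIn K) / halfProd (G₀.numEdgesIn Finset.univ)) := by
    intro n
    induction n with
    | zero => simp [hH, hG.init]
    | succ n ih => exact (hG.lintegral_halfProd_succ_le hK n).trans ih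
  have hfin : ∫⁻ ω, liminf (fun n => ENNReal.ofReal (H n ω)) atTop ∂μ ≠ ∞ := by
    refine ((lintegral_liminf_le hHm).trans_lt ?_).ne
    refine ((liminf_le_liminf (Eventually.of_forall hbd)).trans_eq (liminf_const _)).trans_lt ?_
    exact ENNReal.ofReal_lt_top
  filter_upwards [hp, ae_lt_top (Measurable.liminf hHm) hfin] with ω h1 h2
  have h0 : 0 ≤ p ω := ge_of_tendsto' h1 fun n => ((G n ω).proportion_mem_Icc K).1
  refine lt_of_le_of_ne h0 fun h3 => h2.ne ?_
  rw [← h3] at h1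
  have hpos : ∀ n, 0 < (G n ω).proportion K := fun n =>
    div_pos (by exact_mod_cast hG.numEdgesIn_pos hK n ω)
      (by exact_mod_cast hG.numEdgesIn_univ_pos n ω)
  have h4 : Tendsto (fun n => ((G n ω).proportion K)⁻¹) atTop atTop :=
    tendsto_inv_nhdsGT_zero.comp (tendsto_nhdsWithin_iff.2 ⟨h1, Eventually.of_forall hpos⟩)
  have h5 : Tendsto (fun n => H n ω) atTop atTop := by
    refine tendsto_atTop_mono (fun n => ?_) (Real.tendsto_sqrt_atTop.comp h4)
    refine Real.sqrt_le_iff.2 ⟨(div_pos (halfProd_pos _) (halfProd_pos _)).le, ?_⟩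
    simp only [proportion, inv_div]
    exact div_le_halfProd_div_sq (hG.numEdgesIn_pos hK n ω) ((G n ω).numEdgesIn_le K)
  exact (ENNReal.tendsto_ofReal_atTop.comp h5).liminf_eq

end IsGenBarabasiAlbert

/-! ### The conditional mean of the vertex counts. -/

namespace TypedMultigraph

variable {N : ℕ}

/-- The expected number of vertices with `l` edges of a type in `K` one step after the graph is
`g`, when the number of new edges has law `ρ`. -/
noncomputable def expectedCount (ρ : Measure ℕ) (K : Finset (Fin N)) (l : ℕ)
    (g : TypedMultigraph N) : ℝ :=
  mixedBinomial ρ (g.proportion K) l + ∑ v ∈ Finset.range g.numVertices,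
    ∫ m, binomialMean (g.attachMass fun e => e.1 = v ∧ e.2 ∈ K) m
      (fun j => if g.degreeIn K v + j = l then 1 else 0) ∂ρ

/-- The total degree of the vertices whose degree is one below `l`. -/
noncomputable def sumDegreeBelow (g : TypedMultigraph N) (K : Finset (Fin N)) : ℕ → ℝ
  | 0 => 0
  | l + 1 => l * g.countDegreeIn K l

lemma sum_degreeIn_mul_ite_succ (g : TypedMultigraph N) (K : Finset (Fin N)) (l : ℕ) :
    ∑ v ∈ Finset.range g.numVertices,
      (g.degreeIn K v : ℝ) * (if g.degreeIn K v + 1 = l then 1 else 0) =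
      g.sumDegreeBelow K l := by
  cases l with
  | zero => simp [sumDegreeBelow]
  | succ l =>
    rw [sumDegreeBelow, ← sum_ite_degreeIn, Finset.mul_sum]
    refine Finset.sum_congr rfl fun v _ => ?_
    by_cases h : g.degreeIn K v = l <;> simp [h]

lemma sum_degreeIn_mul_ite (g : TypedMultigraph N) (K : Finset (Fin N)) (l : ℕ) :
    ∑ v ∈ Finset.range g.numVertices,
      (g.degreeIn K v : ℝ) * (if g.degreeIn K v = l then 1 else 0) =
      l * g.countDegreeIn K l := by
  rw [← sum_ite_degreeIn, Finset.mul_sum]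
  refine Finset.sum_congr rfl fun v _ => ?_
  by_cases h : g.degreeIn K v = l <;> simp [h]

/-- A vertex of degree `d ≤ l` contributes an error of order `(d / A) ^ 2 ≤ l * d / A ^ 2`, where
`A` is twice the edge number; larger degrees contribute none. Since the degrees sum to at most `A`,
the total error is of order `l / A` and vanishes in the limit. -/
lemma abs_expectedCount_sub_le {ρ : Measure ℕ} [IsProbabilityMeasure ρ]
    (h2 : Integrable (fun m : ℕ => (m : ℝ) ^ 2) ρ) (g : TypedMultigraph N)
    (hg : 0 < g.numEdgesIn Finset.univ) (K : Finset (Fin N)) (l : ℕ) :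
    |g.expectedCount ρ K l - mixedBinomial ρ (g.proportion K) l - g.countDegreeIn K l -
        (∫ m, (m : ℝ) ∂ρ) / (2 * g.numEdgesIn Finset.univ) *
          (g.sumDegreeBelow K l - l * g.countDegreeIn K l)| ≤
      l * (∫ m, (m : ℝ) * (m - 1) ∂ρ) / (2 * g.numEdgesIn Finset.univ) := by
  have hA : (0 : ℝ) < 2 * g.numEdgesIn Finset.univ := by
    have : (0 : ℝ) < g.numEdgesIn Finset.univ := by exact_mod_cast hg
    linarith
  set A : ℝ := 2 * g.numEdgesIn Finset.univ with hAdef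
  set μ₁ : ℝ := ∫ m, (m : ℝ) ∂ρ
  set μ₂ : ℝ := ∫ m, (m : ℝ) * (m - 1) ∂ρ
  have hμ₂ : 0 ≤ μ₂ := integral_nonneg cast_mul_pred_nonneg
  have hmass : ∀ v ∈ Finset.range g.numVertices,
      g.attachMass (fun e => e.1 = v ∧ e.2 ∈ K) = (g.degreeIn K v : ℝ) / A := fun v hv =>
    g.attachMass_fst_eq K (Finset.mem_range.1 hv)
  have heq : g.expectedCount ρ K l - mixedBinomial ρ (g.proportion K) l - g.countDegreeIn K l -
        μ₁ / A * (g.sumDegreeBelow K l - l * g.countDegreeIn K l) =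
      ∑ v ∈ Finset.range g.numVertices,
        (∫ m, binomialMean (g.attachMass fun e => e.1 = v ∧ e.2 ∈ K) m
          (fun j => if g.degreeIn K v + j = l then 1 else 0) ∂ρ -
        (if g.degreeIn K v = l then 1 else 0) -
        μ₁ * g.attachMass (fun e => e.1 = v ∧ e.2 ∈ K) *
          ((if g.degreeIn K v + 1 = l then 1 else 0) -
            (if g.degreeIn K v = l then 1 else 0))) := by
    rw [← sum_degreeIn_mul_ite_succ, ← sum_degreeIn_mul_ite, ← Finset.sum_sub_distrib,
      Finset.mul_sum, expectedCount, ← sum_ite_degreeIn, add_sub_cancel_left,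
      ← Finset.sum_sub_distrib, ← Finset.sum_sub_distrib]
    refine Finset.sum_congr rfl fun v hv => ?_
    rw [hmass v hv]
    ring
  rw [heq]
  calc _ ≤ ∑ v ∈ Finset.range g.numVertices, l * μ₂ / A ^ 2 * (g.degreeIn K v : ℝ) := by
        refine (Finset.abs_sum_le_sum_abs _ _).trans (Finset.sum_le_sum fun v hv => ?_)
        refine (abs_integral_binomialMean_sub_le (g.attachMass_mem_Icc _) h2 _ _).trans ?_
        split_ifs with h
        · have h' : (g.degreeIn K v : ℝ) ≤ l := by exact_mod_cast h
          rw [hmass v hv, div_pow, mul_div_assoc', div_mul_eq_mul_div]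
          refine div_le_div_of_nonneg_right ?_ (sq_nonneg A)
          have h0 : (0 : ℝ) ≤ g.degreeIn K v := Nat.cast_nonneg _
          have := mul_le_mul_of_nonneg_left (mul_le_mul_of_nonneg_right h' h0) hμ₂
          linarith
        · positivity
    _ = l * μ₂ / A ^ 2 * (2 * g.numEdgesIn K) := by
        rw [← Finset.mul_sum, ← Nat.cast_sum, sum_degreeIn]
        push_cast
        rfl
    _ ≤ l * μ₂ / A ^ 2 * A := by
        have : (g.numEdgesIn K : ℝ) ≤ g.numEdgesIn Finset.univ := by
          exact_mod_cast g.numEdgesIn_le K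
        exact mul_le_mul_of_nonneg_left (by linarith) (by positivity)
    _ = l * μ₂ / A := by field_simp

end TypedMultigraph

/-! ### Almost sure convergence of the degree proportions. -/

namespace IsGenBarabasiAlbert

open TypedMultigraph

variable {Ω : Type*} [MeasurableSpace Ω] {μ : Measure Ω} [IsProbabilityMeasure μ] {N : ℕ}
  {G₀ : TypedMultigraph N} {M : ℕ → Ω → ℕ} {Y : ℕ → ℕ → Ω → ℕ} {T : ℕ → ℕ → Ω → Fin N}
  {G : ℕ → Ω → TypedMultigraph N} {ρ : Measure ℕ}

lemma condExp_countDegreeIn (hG : IsGenBarabasiAlbert μ G₀ M Y T G)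
    (hρ : ∀ n, μ.map (M (n + 1)) = ρ) (K : Finset (Fin N)) (l n : ℕ) :
    μ[fun ω => ((G (n + 1) ω).countDegreeIn K l : ℝ) | graphHistory G n] =ᵐ[μ]
      fun ω => (G n ω).expectedCount ρ K l := by
  have hite : ∀ P : Prop, ∀ [Decidable P], (if P then (1 : ℝ) else 0) ∈ Set.Icc (0 : ℝ) 1 :=
    fun P _ => by split_ifs <;> simp
  set Φ : ℕ → TypedMultigraph N → ℕ → ℕ → ℝ := fun v g _ j =>
    if g.degreeIn K v + j = l then 1 else 0 with hΦ
  set Φ' : TypedMultigraph N → ℕ → ℕ → ℝ := fun _ _ j => if j = l then 1 else 0 with hΦ'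
  set f : ℕ → Ω → ℝ := fun v ω =>
    Φ v (G n ω) (M (n + 1) ω) (hits M Y T n (fun e => e.1 = v ∧ e.2 ∈ K) ω) with hf
  set f' : Ω → ℝ := fun ω => Φ' (G n ω) (M (n + 1) ω) (hits M Y T n (fun e => e.2 ∈ K) ω) with hf'
  have hfi : ∀ v, Integrable (f v) μ := fun v =>
    integrable_of_mem_Icc (hG.measurable_comp_step n _ (Φ v)) fun ω => hite _
  have hfi' : Integrable f' μ :=
    integrable_of_mem_Icc (hG.measurable_comp_step n _ Φ') fun ω => hite _
  have hX : (fun ω => ((G (n + 1) ω).countDegreeIn K l : ℝ)) =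
      f' + ∑ v ∈ Finset.range (G₀.numVertices + n), f v := by
    funext ω
    rw [hG.countDegreeIn_succ, Pi.add_apply, Finset.sum_apply]
  rw [hX]
  filter_upwards [condExp_add hfi' (integrable_finsetSum' _ fun v _ => hfi v)
      (graphHistory G n),
    condExp_finsetSum (s := Finset.range (G₀.numVertices + n)) (fun v _ => hfi v)
      (graphHistory G n),
    hG.condExp_step n (fun e => e.2 ∈ K) (Φ := Φ') (C := 1) (fun _ _ _ => hite _),
    ae_all_iff.2 fun v => hG.condExp_step n (fun e => e.1 = v ∧ e.2 ∈ K) (Φ := Φ v) (C := 1)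
      (fun _ _ _ => hite _)] with ω h1 h2 h3 h4
  rw [h1, Pi.add_apply, h2, Finset.sum_apply, h3, expectedCount, hG.numVertices_eq, mixedBinomial,
    attachMass_snd_mem, hρ]
  congr 1
  refine Finset.sum_congr rfl fun v _ => ?_
  rw [h4 v, hρ]

/-- The fluctuations of the vertex counts around their conditional means are of lower order. -/
lemma ae_tendsto_sum_sub_expectedCount_div (hG : IsGenBarabasiAlbert μ G₀ M Y T G)
    (hρ : ∀ n, μ.map (M (n + 1)) = ρ) (h2 : Integrable (fun m : ℕ => (m : ℝ) ^ 2) ρ)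
    (K : Finset (Fin N)) (l : ℕ) :
    ∀ᵐ ω ∂μ, Tendsto (fun n : ℕ => (∑ i ∈ Finset.range n,
      (((G (i + 1) ω).countDegreeIn K l : ℝ) - (G i ω).expectedCount ρ K l)) / (n : ℝ))
      atTop (𝓝 0) := by
  have hprob := hG.isProbabilityMeasure_law hρ
  have hXm : ∀ n, Measurable[graphHistory G n] fun ω => ((G n ω).countDegreeIn K l : ℝ) :=
    fun n => measurable_comp_graph (fun g => (g.countDegreeIn K l : ℝ)) n
  have hXi : ∀ n, Integrable (fun ω => ((G n ω).countDegreeIn K l : ℝ)) μ := by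
    intro n
    refine integrable_of_mem_Icc (C := ((G₀.numVertices + n : ℕ) : ℝ))
      ((hXm n).mono (hG.graphHistory_le n) le_rfl) fun ω => ⟨Nat.cast_nonneg _, ?_⟩
    rw [← hG.numVertices_eq n ω]
    exact_mod_cast (Finset.card_filter_le _ _).trans (Finset.card_range _).le
  -- The strong law is applied to increments, which are bounded in `L²`. Subtracting the present
  -- count does not alter the deviation from the conditional mean.
  set ξ : ℕ → Ω → ℝ := fun n ω =>
    ((G (n + 1) ω).countDegreeIn K l : ℝ) - (G n ω).countDegreeIn K l with hξ
  have hξm : ∀ n, Measurable[graphHistory G (n + 1)] (ξ n) := fun n =>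
    (hXm (n + 1)).sub ((hXm n).mono (hG.filtration.mono n.le_succ) le_rfl)
  have hsq : Integrable (fun m : ℕ => (1 + (m : ℝ)) ^ 2) ρ := by
    refine (((integrable_const 1).add ((integrable_cast h2).const_mul 2)).add h2).congr
      (Eventually.of_forall fun m => ?_)
    simp only [Pi.add_apply]
    ring
  have hsqM : ∀ n, Integrable (fun ω => (1 + (M (n + 1) ω : ℝ)) ^ 2) μ := fun n =>
    hG.integrable_step_law hρ n hsq
  have hle : ∀ n ω, ξ n ω ^ 2 ≤ (1 + (M (n + 1) ω : ℝ)) ^ 2 := fun n ω => by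
    rw [← sq_abs (ξ n ω)]
    exact pow_le_pow_left₀ (abs_nonneg _) (hG.abs_countDegreeIn_succ_sub_le K l n ω) 2
  have hξmeas : ∀ n, AEStronglyMeasurable (ξ n) μ := fun n =>
    ((hξm n).mono (hG.graphHistory_le _) le_rfl).aestronglyMeasurable
  have hξ2 : ∀ n, Integrable (fun ω => ξ n ω ^ 2) μ := fun n =>
    (hsqM n).mono' ((hξmeas n).pow 2) (Eventually.of_forall fun ω => by
      rw [Real.norm_of_nonneg (sq_nonneg _)]
      exact hle n ω)
  have hslln := ae_tendsto_sum_sub_condExp_div hG.filtration (ξ := ξ)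
    (C := ∫ m, (1 + (m : ℝ)) ^ 2 ∂ρ) (fun n => (hξm n).stronglyMeasurable)
    (fun n => (memLp_two_iff_integrable_sq (hξmeas n)).2 (hξ2 n))
    (fun n => (integral_mono (hξ2 n) (hsqM n) (hle n)).trans_eq
      (hG.integral_step_law hρ n fun m => (1 + (m : ℝ)) ^ 2))
  have hcond : ∀ n, μ[ξ n | graphHistory G n] =ᵐ[μ] fun ω =>
      (G n ω).expectedCount ρ K l - (G n ω).countDegreeIn K l := by
    intro n
    filter_upwards [condExp_sub (hXi (n + 1)) (hXi n) (graphHistory G n),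
      hG.condExp_countDegreeIn hρ K l n] with ω h1 h3
    rw [condExp_of_stronglyMeasurable (hG.graphHistory_le n) (hXm n).stronglyMeasurable
      (hXi n)] at h1
    rw [← h3]
    exact h1
  filter_upwards [hslln, ae_all_iff.2 hcond] with ω h hc
  refine h.congr fun n => ?_
  congr 1
  refine Finset.sum_congr rfl fun i _ => ?_
  have h3 : (μ[ξ i | hG.filtration i]) ω = _ := hc i
  rw [h3, hξ]
  ring

lemma numVertices_pos (hG : IsGenBarabasiAlbert μ G₀ M Y T G) : 0 < G₀.numVertices := by
  obtain ⟨ω⟩ : Nonempty Ω := μ.nonempty_of_neZero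
  have h := hG.numEdgesIn_univ_pos 0 ω
  rw [hG.init, numEdgesIn_univ, Multiset.card_pos_iff_exists_mem] at h
  obtain ⟨e, he⟩ := h
  exact (Nat.zero_le _).trans_lt (G₀.mem_vertices e he _ (Sym2.out_fst_mem e.1))

/-- The proportion of vertices with `l` edges of a type in `K` converges, and the limit is a
function of the limiting proportion of edges of a type in `K`. -/
theorem ae_tendsto_countDegreeIn_div (hG : IsGenBarabasiAlbert μ G₀ M Y T G)
    (hρ : ∀ n, μ.map (M (n + 1)) = ρ) (h2 : Integrable (fun m : ℕ => (m : ℝ) ^ 2) ρ)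
    (K : Finset (Fin N)) {p : Ω → ℝ}
    (hp : ∀ᵐ ω ∂μ, Tendsto (fun n => (G n ω).proportion K) atTop (𝓝 (p ω))) :
    ∀ᵐ ω ∂μ, ∀ l, Tendsto
      (fun n => ((G n ω).countDegreeIn K l : ℝ) / ((G n ω).numVertices : ℝ)) atTop
      (𝓝 (degreeLimit (mixedBinomial ρ (p ω)) l)) := by
  have hprob := hG.isProbabilityMeasure_law hρ
  have hm := hG.one_le_integral_law hρ h2
  have hv := hG.numVertices_pos
  set v := G₀.numVertices
  set μ₁ : ℝ := ∫ m, (m : ℝ) ∂ρ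
  set μ₂ : ℝ := ∫ m, (m : ℝ) * (m - 1) ∂ρ
  filter_upwards [hp, hG.ae_tendsto_numEdgesIn_div hρ h2,
    ae_all_iff.2 fun l => hG.ae_tendsto_sum_sub_expectedCount_div hρ h2 K l] with ω hpω hA hS
  simp only [hG.numVertices_eq, Nat.cast_add]
  set A : ℕ → ℝ := fun n => 2 * (G n ω).numEdgesIn Finset.univ with hAdef
  have hApos : ∀ n, 0 < A n := fun n => by
    have : (0 : ℝ) < (G n ω).numEdgesIn Finset.univ := by
      exact_mod_cast hG.numEdgesIn_univ_pos n ω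
    simp only [hAdef]
    linarith
  have hv' : (0 : ℝ) < v := by exact_mod_cast hv
  have hV : ∀ n : ℕ, (0 : ℝ) < v + n := fun n => by positivity
  -- The mean number of new edges cancels against the growth of `A`; this leaves the universal rate
  -- `1/2`, hence the exponent `3`.
  have hratio : Tendsto (fun n : ℕ => μ₁ / A n * ((v : ℝ) + n)) atTop (𝓝 (1 / 2)) := by
    have h0 := tendsto_inv_atTop_nhds_zero_nat (𝕜 := ℝ)
    have h1 := ((h0.const_mul (v : ℝ)).add_const 1).mul
      ((hA.const_mul 2).inv₀ (by positivity)) |>.const_mul μ₁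
    have h3 : μ₁ * (((v : ℝ) * 0 + 1) * (2 * μ₁)⁻¹) = 1 / 2 := by
      field_simp; ring
    rw [h3] at h1
    refine h1.congr' ?_
    filter_upwards [eventually_gt_atTop 0] with n hn
    have hn' : (n : ℝ) ≠ 0 := by positivity
    have := (hApos n).ne'
    have h4 : ((G n ω).numEdgesIn Finset.univ : ℝ) ≠ 0 := by
      simp only [hAdef] at this
      exact right_ne_zero_of_mul this
    simp only [hAdef]
    field_simp
  have hAinv : Tendsto (fun n => (A n)⁻¹) atTop (𝓝 0) := by
    have h1 := (hA.const_mul 2).inv₀ (by positivity) |>.mul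
      (tendsto_inv_atTop_nhds_zero_nat (𝕜 := ℝ))
    rw [mul_zero] at h1
    refine h1.congr' ?_
    filter_upwards [eventually_gt_atTop 0] with n hn
    have hn' : (n : ℝ) ≠ 0 := by positivity
    simp only [hAdef]
    rw [← mul_inv]
    congr 1
    field_simp
  have hstep : ∀ (l : ℕ) (y : ℝ),
      Tendsto (fun n => (G n ω).sumDegreeBelow K l / ((v : ℝ) + n)) atTop (𝓝 y) →
      Tendsto (fun n => ((G n ω).countDegreeIn K l : ℝ) / ((v : ℝ) + n)) atTop
        (𝓝 ((mixedBinomial ρ (p ω) l + 1 / 2 * y) / (1 + 1 / 2 * l))) := by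
    intro l y hy
    have hmb := tendsto_mixedBinomial (ρ := ρ) (fun n => (G n ω).proportion_mem_Icc K) hpω l
    set γ : ℕ → ℝ := fun n => μ₁ / A n * ((v : ℝ) + n) * l with hγ
    set X : ℕ → ℝ := fun n => ((G n ω).countDegreeIn K l : ℝ)
    have herr : Tendsto (fun n => (G n ω).expectedCount ρ K l -
        mixedBinomial ρ ((G n ω).proportion K) l - X n -
        μ₁ / A n * ((G n ω).sumDegreeBelow K l - l * X n)) atTop (𝓝 0) := by
      refine squeeze_zero_norm (fun n => ?_) (by simpa using hAinv.const_mul (l * μ₂))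
      exact abs_expectedCount_sub_le h2 (G n ω) (hG.numEdgesIn_univ_pos n ω) K l
    -- With this `β` the recursion holds identically; all the content is in `β` tending to
    -- `mixedBinomial ρ (p ω) l + 1 / 2 * y`.
    refine tendsto_div_of_recursion (γ := γ)
      (β := fun n => (G n ω).expectedCount ρ K l - X n + γ n * (X n / ((v : ℝ) + n)))
      (Δ := fun n => X (n + 1) - (G n ω).expectedCount ρ K l) hv
      (fun n => ?_) ?_ (hratio.mul_const _) ?_ (fun n => ?_)
    · have := hApos n
      have := hV n
      positivity
    · have h := (herr.add hmb).add (hratio.mul hy)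
      rw [zero_add] at h
      refine h.congr fun n => ?_
      have h1 := (hV n).ne'
      have h3 := (hApos n).ne'
      simp only [hγ]
      field_simp
      ring
    · refine squeeze_zero_norm' (a := fun n : ℕ => |(∑ i ∈ Finset.range n,
        (X (i + 1) - (G i ω).expectedCount ρ K l)) / (n : ℝ)|) ?_ (by simpa using (hS l).abs)
      filter_upwards [eventually_gt_atTop 0] with n hn
      have hn' : (0 : ℝ) < n := by exact_mod_cast hn
      rw [norm_div, Real.norm_eq_abs, Real.norm_of_nonneg (hV n).le, abs_div, Nat.abs_cast]
      exact div_le_div_of_nonneg_left (abs_nonneg _) hn' (by linarith)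
    · ring
  intro l
  induction l with
  | zero =>
    have h := hstep 0 0 (by simp [sumDegreeBelow])
    simpa [degreeLimit] using h
  | succ l ih =>
    have h := hstep (l + 1) (l * degreeLimit (mixedBinomial ρ (p ω)) l) (by
      simp only [sumDegreeBelow, mul_div_assoc]
      exact ih.const_mul _)
    have h3 : (mixedBinomial ρ (p ω) (l + 1) +
        1 / 2 * (l * degreeLimit (mixedBinomial ρ (p ω)) l)) / (1 + 1 / 2 * ((l + 1 : ℕ) : ℝ)) =
        degreeLimit (mixedBinomial ρ (p ω)) (l + 1) := by
      rw [degreeLimit]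
      push_cast
      field_simp
      ring
    rwa [h3] at h

end IsGenBarabasiAlbert

/-! ### Conclusion. -/

/-- Positivity of `p` is essential: at `p = 0` the constant is `0`. The term linear in `p` already
makes it positive otherwise. -/
lemma degreeLimit_mixedBinomial_spec {ρ : Measure ℕ} [IsProbabilityMeasure ρ]
    (h2 : Integrable (fun m : ℕ => (m : ℝ) ^ 2) ρ) (h1 : 0 < ∫ m, (m : ℝ) ∂ρ) {p : ℝ}
    (hp : p ∈ Set.Ioc (0 : ℝ) 1) :
    HasSum (degreeLimit (mixedBinomial ρ p)) 1 ∧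
    0 < 2 * ((∫ m, (m : ℝ) * (m - 1) ∂ρ) * p ^ 2 + 2 * ((∫ m, (m : ℝ) ∂ρ) * p)) ∧
    Tendsto (fun l : ℕ => degreeLimit (mixedBinomial ρ p) l * (l : ℝ) ^ 3) atTop
      (𝓝 (2 * ((∫ m, (m : ℝ) * (m - 1) ∂ρ) * p ^ 2 + 2 * ((∫ m, (m : ℝ) ∂ρ) * p)))) := by
  have hp' : p ∈ Set.Icc (0 : ℝ) 1 := ⟨hp.1.le, hp.2⟩
  have hc := hasSum_mul_succ_mixedBinomial hp' h2
  refine ⟨hasSum_degreeLimit (mixedBinomial_nonneg hp') (hasSum_mixedBinomial hp') hc, ?_,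
    tendsto_degreeLimit_mul_cube hc⟩
  have h3 : 0 ≤ ∫ m, (m : ℝ) * (m - 1) ∂ρ := integral_nonneg cast_mul_pred_nonneg
  have h4 := hp.1
  positivity

/-- The term `l = 2` of a finite sum is finite, and its factors other than the second moment are
neither `0` nor infinite. -/
lemma integrable_sq_of_tsum_lt_top {Ω : Type*} [MeasurableSpace Ω] {μ : Measure Ω} {M : Ω → ℕ}
    (hM : Measurable M) (hseries : ∃ z : ℝ≥0, 1 < z ∧
      ∑' l : ℕ+, (∫⁻ ω, (M ω : ℝ≥0∞) ^ (l : ℕ) ∂μ) / (((l : ℕ) * (l : ℕ)! : ℕ) : ℝ≥0∞) *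
        (z : ℝ≥0∞) ^ (l : ℕ) < ∞) :
    Integrable (fun m : ℕ => (m : ℝ) ^ 2) (μ.map M) := by
  obtain ⟨z, hz, hsum⟩ := hseries
  have h1 := ENNReal.ne_top_of_tsum_ne_top hsum.ne 2
  have hz0 : (z : ℝ≥0∞) ≠ 0 := by
    exact_mod_cast (zero_lt_one.trans hz).ne'
  have h3 : ∫⁻ ω, (M ω : ℝ≥0∞) ^ 2 ∂μ ≠ ∞ := by
    intro h
    refine h1 ?_
    have h4 : ((2 : ℕ+) : ℕ) = 2 := rfl
    rw [h4, h, ENNReal.top_div_of_ne_top (by simp), ENNReal.top_mul (pow_ne_zero _ hz0)]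
  rw [integrable_map_measure (measurable_of_countable _).aestronglyMeasurable hM.aemeasurable]
  refine ⟨((measurable_of_countable _).comp hM).aestronglyMeasurable, ?_⟩
  refine lt_of_eq_of_lt (lintegral_congr fun ω => ?_) (lt_top_iff_ne_top.2 h3)
  simp [enorm_pow]

theorem mainTheorem4 {Ω Ω' : Type*} [MeasurableSpace Ω] [MeasurableSpace Ω']
    (μ : Measure Ω) [IsProbabilityMeasure μ] (μ' : Measure Ω') [IsProbabilityMeasure μ']
    {N : ℕ} (G₀ : TypedMultigraph N) (M : ℕ → Ω → ℕ) (Y : ℕ → ℕ → Ω → ℕ) (T : ℕ → ℕ → Ω → Fin N)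
    (G : ℕ → Ω → TypedMultigraph N) (L : Ω' → ℕ)
    (hG : IsGenBarabasiAlbert μ G₀ M Y T G)
    (hM : EdgeNumbersConverge μ M μ' L)
    (hident : ∀ n, IdentDistrib (M (n + 1)) (M 1) μ μ)
    (hseries : ∃ z : ℝ≥0, 1 < z ∧
      ∑' l : ℕ+, (∫⁻ ω, (M 1 ω : ℝ≥0∞) ^ (l : ℕ) ∂μ) / (((l : ℕ) * (l : ℕ)! : ℕ) : ℝ≥0∞) *
        (z : ℝ≥0∞) ^ (l : ℕ) < ∞) :
    (∀ k : Fin N, ∃ (x : ℕ → Ω → ℝ) (C : Ω → ℝ), (∀ l, Measurable (x l)) ∧ Measurable C ∧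
      ∀ᵐ ω ∂μ,
        (∀ l, Tendsto
          (fun n => ((G n ω).countTypeDegree k l : ℝ) / ((G n ω).numVertices : ℝ))
          atTop (𝓝 (x l ω))) ∧
        HasSum (fun l => x l ω) 1 ∧
        0 < C ω ∧
        Tendsto (fun l : ℕ => x l ω * (l : ℝ) ^ 3) atTop (𝓝 (C ω))) ∧
    (∃ (z : ℕ → ℝ) (C : ℝ),
      (∀ᵐ ω ∂μ, ∀ d, Tendsto
        (fun n => ((G n ω).countDegree d : ℝ) / ((G n ω).numVertices : ℝ))
        atTop (𝓝 (z d))) ∧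
      HasSum z 1 ∧
      0 < C ∧
      Tendsto (fun d : ℕ => z d * (d : ℝ) ^ 3) atTop (𝓝 C)) := by
  have hρ : ∀ n, μ.map (M (n + 1)) = μ.map (M 1) := fun n => (hident n).map_eq
  have hprob := hG.isProbabilityMeasure_law hρ
  have h2 := integrable_sq_of_tsum_lt_top (hG.measurable_M 0) hseries
  have h1 := zero_lt_one.trans_le (hG.one_le_integral_law hρ h2)
  set ρ := μ.map (M 1)
  constructor
  · intro k
    obtain ⟨p, hpm, hp⟩ := hG.exists_tendsto_proportion {k}
    refine ⟨fun l ω => degreeLimit (mixedBinomial ρ (p ω)) l, fun ω =>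
      2 * ((∫ m, (m : ℝ) * (m - 1) ∂ρ) * p ω ^ 2 + 2 * ((∫ m, (m : ℝ) ∂ρ) * p ω)),
      fun l => (measurable_degreeLimit l).comp hpm, by fun_prop, ?_⟩
    filter_upwards [hp, hG.ae_limit_pos (Finset.singleton_nonempty k) hp,
      hG.ae_tendsto_countDegreeIn_div hρ h2 {k} hp] with ω h3 h4 h5
    refine ⟨fun l => ?_, degreeLimit_mixedBinomial_spec h2 h1
      ⟨h4, le_of_tendsto' h3 fun n => ((G n ω).proportion_mem_Icc {k}).2⟩⟩
    simpa only [TypedMultigraph.countDegreeIn, TypedMultigraph.degreeIn,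
      TypedMultigraph.countTypeDegree, Finset.sum_singleton] using h5 l
  · refine ⟨degreeLimit (mixedBinomial ρ 1), _, ?_,
      degreeLimit_mixedBinomial_spec h2 h1 ⟨zero_lt_one, le_rfl⟩⟩
    -- For the set of all types the proportion is constantly `1`, so the limits do not depend on
    -- `ω`.
    refine hG.ae_tendsto_countDegreeIn_div hρ h2 Finset.univ (p := fun _ => 1)
      (Eventually.of_forall fun ω => ?_)
    refine tendsto_const_nhds.congr fun n => ?_
    rw [TypedMultigraph.proportion, div_self]
    exact_mod_cast (hG.numEdgesIn_univ_pos n ω).ne'
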